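/- Let $G$ be a group of type $FP_\infty$, i.e. the trivial $\mathbb{Z}G$-module $\mathbb{Z}$ has a resolution by finitely generated projective $\mathbb{Z}G$-modules, and let $q\ge 0$. For each $n$ let $V_n=H^q(G^n;\mathbb{Q})$ (trivial coefficients), with the action of $S_n$ induced by permuting the factors of $G^n$, and let $\phi_n\colon V_n\to V_{n+1}$ be the map induced by the homomorphism $G^{n+1}\to G^n$ forgetting the last coordinate. For a partition $\lambda=(\lambda_1\ge\lambda_2\ge\cdots)$ of $k$ and $n\ge k+\lambda_1$, let $V(\lambda)_n$ denote the irreducible rational $S_n$-representation attached to the partition $(n-k,\lambda_1,\lambda_2,\ldots)$ of $n$. Then all the $V_n$ are finite dimensional, $\{V_n,\phi_n\}$ is a consistent sequence (each $\phi_n$ is equivariant with respect to the inclusion $S_n\hookrightarrow S_{n+1}$ as the stabilizer of $n+1$), all the $\phi_n$ are injective, and: (Monotonicity) for all $n\ge 2q$, all partitions $\lambda$ with $n\ge|\lambda|+\lambda_1$ and all $k\ge0$, if $W\subseteq V_n$ is a subrepresentation isomorphic to $V(\lambda)_n^{\oplus k}$, then the $S_{n+1}$-span of $\phi_n(W)$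 contains a subrepresentation isomorphic to $V(\lambda)_{n+1}^{\oplus k}$. (Uniform representation stability with stable range $n\ge 2q$) for all $n\ge2q$, the map $\phi_n$ is injective and the $S_{n+1}$-span of $\phi_n(V_n)$ is $V_{n+1}$; and for each partition $\lambda$ the multiplicity of $V(\lambda)_n$ in $V_n$ is constant for $n\ge 2q$, where the multiplicity is taken to be $0$ if $n<|\lambda|+\lambda_1$. -/

import Mathlib

open CategoryTheory

noncomputable section

namespace RepStab

/-! ### Irreducible representations of the symmetric groups -/

/-- The group algebra `ℚ[S_n]`, where `S_n` is the group of permutations of `Fin n`. -/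
abbrev SymAlg (n : ℕ) : Type := MonoidAlgebra ℚ (Equiv.Perm (Fin n))

/-- A (bijective) numbering of the boxes of a Young diagram with `n` boxes. -/
def numbering {n : ℕ} (μ : YoungDiagram) (h : μ.card = n) : μ.cells ≃ Fin n :=
  μ.cells.equivFinOfCardEq h

/-- The row of the box with number `i`. -/
def rowOf {n : ℕ} (μ : YoungDiagram) (h : μ.card = n) (i : Fin n) : ℕ :=
  ((numbering μ h).symm i).1.1

/-- The column of the box with number `i`. -/
def colOf {n : ℕ} (μ : YoungDiagram) (h : μ.card = n) (i : Fin n) : ℕ :=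
  ((numbering μ h).symm i).1.2

/-- The permutations preserving each row of the numbered diagram. -/
def rowPerms {n : ℕ} (μ : YoungDiagram) (h : μ.card = n) : Finset (Equiv.Perm (Fin n)) :=
  Finset.univ.filter fun σ => ∀ i, rowOf μ h (σ i) = rowOf μ h i

/-- The permutations preserving each column of the numbered diagram. -/
def colPerms {n : ℕ} (μ : YoungDiagram) (h : μ.card = n) : Finset (Equiv.Perm (Fin n)) :=
  Finset.univ.filter fun σ => ∀ i, colOf μ h (σ i) = colOf μ h i

/-- The Young symmetrizer `c_μ = (∑_{σ preserves rows} σ) * (∑_{σ preserves columns} sgn(σ) σ)`. -/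
def youngSymmetrizer {n : ℕ} (μ : YoungDiagram) (h : μ.card = n) : SymAlg n :=
  (∑ σ ∈ rowPerms μ h, MonoidAlgebra.single σ (1 : ℚ)) *
    ∑ σ ∈ colPerms μ h, MonoidAlgebra.single σ (((Equiv.Perm.sign σ : ℤ) : ℚ))

/-- The irreducible rational `S_n`-representation `V_μ` attached to a partition `μ` of `n`: the left
ideal `ℚ[S_n] c_μ` (up to isomorphism independent of the numbering of the boxes). -/
abbrev irrep {n : ℕ} (μ : YoungDiagram) (h : μ.card = n) : Submodule (SymAlg n) (SymAlg n) :=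
  Submodule.span (SymAlg n) {youngSymmetrizer μ h}

/-- `λ[n]` is defined exactly when `n ≥ |λ| + λ₁`. -/
def PaddedDefined (l : YoungDiagram) (n : ℕ) : Prop := l.card + l.rowLen 0 ≤ n

theorem PaddedDefined.succ {l : YoungDiagram} {n : ℕ} (h : PaddedDefined l n) :
    PaddedDefined l (n + 1) := Nat.le_succ_of_le h

theorem padded_sortedGE {l : YoungDiagram} {n : ℕ} (h : PaddedDefined l n) :
    ((n - l.card) :: l.rowLens).SortedGE := by
  unfold PaddedDefined at h
  rw [List.sortedGE_iff_pairwise, List.pairwise_cons]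
  refine ⟨fun a ha => ?_, (YoungDiagram.rowLens_sorted l).pairwise⟩
  simp only [YoungDiagram.rowLens, List.mem_map, List.mem_range] at ha
  obtain ⟨i, -, rfl⟩ := ha
  have := l.rowLen_anti 0 i (Nat.zero_le i)
  omega

/-- The padded partition `λ[n] = (n - |λ|, λ₁, λ₂, …)`. -/
def padded (l : YoungDiagram) (n : ℕ) (h : PaddedDefined l n) : YoungDiagram :=
  YoungDiagram.ofRowLens ((n - l.card) :: l.rowLens) (padded_sortedGE h)

theorem card_padded (l : YoungDiagram) (n : ℕ) (h : PaddedDefined l n) :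
    (padded l n h).card = n := by
  have h1 : YoungDiagram.cellsOfRowLens l.rowLens = l.cells :=
    congrArg YoungDiagram.cells (YoungDiagram.ofRowLens_to_rowLens_eq_self (μ := l))
  change (YoungDiagram.cellsOfRowLens ((n - l.card) :: l.rowLens)).card = n
  rw [YoungDiagram.cellsOfRowLens, h1, Finset.card_union_of_disjoint]
  · simp only [Finset.card_product, Finset.card_singleton, Finset.card_range, Finset.card_map]
    unfold PaddedDefined at h
    have : l.cells.card = l.card := rfl
    omega
  · rw [Finset.disjoint_left]
    rintro ⟨a, b⟩ h1 h2
    simp at h1 h2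
    omega

/-- The irreducible representation `V(λ)_n = V_{λ[n]}` of `S_n`, for `n ≥ |λ| + λ₁`. -/
abbrev paddedIrrep (l : YoungDiagram) (n : ℕ) (h : PaddedDefined l n) :
    Submodule (SymAlg n) (SymAlg n) :=
  irrep (padded l n h) (card_padded l n h)

/-! ### Representation stability -/

/-- The largest `k` such that `S^{⊕ k}` embeds into `M`. For a simple module `S` and a
finite-dimensional semisimple `M` it is the multiplicity of `S` in `M`. -/
def multiplicity (R S M : Type*) [Ring R] [AddCommGroup S] [Module R S] [AddCommGroup M]
    [Module R M] : ℕ :=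
  sSup {k : ℕ | ∃ f : (Fin k → S) →ₗ[R] M, Function.Injective f}

/-- The natural inclusion `S_n ↪ S_{n+1}` as the permutations fixing the last point. -/
def permIncl (n : ℕ) : Equiv.Perm (Fin n) →* Equiv.Perm (Fin (n + 1)) :=
  Equiv.Perm.viaEmbeddingHom Fin.castSuccEmb

section Sequences

variable {V : ℕ → Type*} [∀ n, AddCommGroup (V n)] [∀ n, Module ℚ (V n)]

/-- The maps `φ n : V n → V (n+1)` are equivariant with respect to `S_n ↪ S_{n+1}`. -/
def IsConsistentAt (ρ : ∀ n, Representation ℚ (Equiv.Perm (Fin n)) (V n))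
    (φ : ∀ n, V n →ₗ[ℚ] V (n + 1)) (n : ℕ) : Prop :=
  ∀ (σ : Equiv.Perm (Fin n)) (v : V n), φ n (ρ n σ v) = ρ (n + 1) (permIncl n σ) (φ n v)

/-- The `S_{n+1}`-span of `φ_n(W)`, as a `ℚ[S_{n+1}]`-submodule of `V (n+1)`,
for an `S_n`-subrepresentation `W` of `V n`. -/
def spanImage (ρ : ∀ n, Representation ℚ (Equiv.Perm (Fin n)) (V n))
    (φ : ∀ n, V n →ₗ[ℚ] V (n + 1)) (n : ℕ) (W : Submodule (SymAlg n) (ρ n).asModule) :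
    Submodule (SymAlg (n + 1)) (ρ (n + 1)).asModule :=
  Submodule.span (SymAlg (n + 1))
    {x | ∃ w ∈ W, (ρ (n + 1)).asModuleEquiv x = φ n ((ρ n).asModuleEquiv w)}

open Classical in
/-- The multiplicity `c_λ(V_n)` of `V(λ)_n` in `V_n`; it is `0` when `V(λ)_n` is not defined. -/
def mult (ρ : ∀ n, Representation ℚ (Equiv.Perm (Fin n)) (V n)) (l : YoungDiagram) (n : ℕ) : ℕ :=
  if h : PaddedDefined l n then multiplicity (SymAlg n) (paddedIrrep l n h) (ρ n).asModule else 0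

/-- Uniform representation stability with stable range `n ≥ N` of a sequence of finite-dimensional
rational `S_n`-representations. -/
structure UniformlyRepStable (ρ : ∀ n, Representation ℚ (Equiv.Perm (Fin n)) (V n))
    (φ : ∀ n, V n →ₗ[ℚ] V (n + 1)) (N : ℕ) : Prop where
  finiteDimensional : ∀ n, FiniteDimensional ℚ (V n)
  consistent : ∀ n, N ≤ n → IsConsistentAt ρ φ n
  injective : ∀ n, N ≤ n → Function.Injective (φ n)
  surjective : ∀ n, N ≤ n → spanImage ρ φ n ⊤ = ⊤
  multiplicityStable : ∀ l : YoungDiagram, ∃ c : ℕ, ∀ n, N ≤ n → mult ρ l n = c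

/-- A consistent sequence with injective maps is monotone for `n ≥ N` if for each
`W ≤ V_n` isomorphic to `V(λ)_n^{⊕ k}` the `S_{n+1}`-span of `φ_n(W)` contains a copy of
`V(λ)_{n+1}^{⊕ k}`. -/
structure MonotoneSeq (ρ : ∀ n, Representation ℚ (Equiv.Perm (Fin n)) (V n))
    (φ : ∀ n, V n →ₗ[ℚ] V (n + 1)) (N : ℕ) : Prop where
  consistent : ∀ n, IsConsistentAt ρ φ n
  injective : ∀ n, Function.Injective (φ n)
  span_contains : ∀ n, N ≤ n → ∀ (l : YoungDiagram) (h : PaddedDefined l n) (k : ℕ)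
    (W : Submodule (SymAlg n) (ρ n).asModule),
    Nonempty (W ≃ₗ[SymAlg n] (Fin k → paddedIrrep l n h)) →
    ∃ U : Submodule (SymAlg (n + 1)) (ρ (n + 1)).asModule, U ≤ spanImage ρ φ n W ∧
      Nonempty (U ≃ₗ[SymAlg (n + 1)] (Fin k → paddedIrrep l (n + 1) h.succ))

end Sequences

/-! ### Groups of type `FP_∞` and the cohomology of `G^n` -/

/-- The representation `A` is finitely generated as a module over the group algebra `k[G]`. -/
def IsFinitelyGenerated {k G : Type} [CommRing k] [Group G] (A : Rep.{0} k G) : Prop :=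
  Module.Finite (MonoidAlgebra k G) A.ρ.asModule

/-- `G` is of type `FP_∞`: the trivial `ℤG`-module `ℤ` has a projective resolution by finitely
generated `ℤG`-modules. -/
def IsFPInfty (G : Type) [Group G] : Prop :=
  ∃ P : ProjectiveResolution (Rep.trivial ℤ G ℤ),
    ∀ i, IsFinitelyGenerated (P.complex.X i)

/-- The group cohomology `H^q(G; ℚ)` with trivial coefficients. -/
abbrev rationalCohomology (G : Type) [Group G] (q : ℕ) : ModuleCat ℚ :=
  groupCohomology (Rep.trivial ℚ G ℚ) q

/-- The map `f^* : H^q(H; ℚ) → H^q(G; ℚ)` induced by a homomorphism `f : G → H`. -/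
def pullback {G H : Type} [Group G] [Group H] (f : G →* H) (q : ℕ) :
    rationalCohomology H q →ₗ[ℚ] rationalCohomology G q :=
  (groupCohomology.map (A := Rep.trivial ℚ H ℚ) (B := Rep.trivial ℚ G ℚ) f
    (Rep.ofHom ⟨LinearMap.id, fun _ => rfl⟩) q).hom

theorem pullback_id (G : Type) [Group G] (q : ℕ) :
    pullback (MonoidHom.id G) q = LinearMap.id :=
  congrArg ModuleCat.Hom.hom (groupCohomology.map_id (B := Rep.trivial ℚ G ℚ) (n := q))

theorem pullback_comp {G H K : Type} [Group G] [Group H] [Group K] (f : H →* K) (g : G →* H)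
    (q : ℕ) : pullback (f.comp g) q = pullback g q ∘ₗ pullback f q :=
  congrArg ModuleCat.Hom.hom (groupCohomology.map_comp (A := Rep.trivial ℚ K ℚ)
    (B := Rep.trivial ℚ H ℚ) (C := Rep.trivial ℚ G ℚ) f g
    (Rep.ofHom ⟨LinearMap.id, fun _ => rfl⟩) (Rep.ofHom ⟨LinearMap.id, fun _ => rfl⟩) q)

/-- The homomorphism `G^n → G^m`, `g ↦ g ∘ e`, given by a map of index sets `e`. -/
def reindex (G : Type) [Group G] {m n : ℕ} (e : Fin m → Fin n) : (Fin n → G) →* (Fin m → G) where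
  toFun g := g ∘ e
  map_one' := rfl
  map_mul' _ _ := rfl

/-- The action of `S_n` on `H^q(G^n; ℚ)` induced by the permutation action
`(σ • g)_i = g_{σ⁻¹ i}` on `G^n`: `σ` acts by the map induced by `g ↦ σ⁻¹ • g = g ∘ σ`. -/
def powerRep (G : Type) [Group G] (q n : ℕ) :
    Representation ℚ (Equiv.Perm (Fin n)) (rationalCohomology (Fin n → G) q) where
  toFun σ := pullback (reindex G σ) q
  map_one' := pullback_id (Fin n → G) q
  map_mul' σ τ := pullback_comp (reindex G τ) (reindex G σ) q

/-- The map `φ_n : H^q(G^n; ℚ) → H^q(G^{n+1}; ℚ)` induced by the homomorphism `G^{n+1} → G^n`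
forgetting the last coordinate. -/
def forgetMap (G : Type) [Group G] (q n : ℕ) :
    rationalCohomology (Fin n → G) q →ₗ[ℚ] rationalCohomology (Fin (n + 1) → G) q :=
  pullback (reindex G Fin.castSucc) q

end RepStab

end

/-! Write V_n = H^q(G^n; ℚ). Inserting identity coordinates gives, besides φ, a retraction `res` of
φ and commuting idempotents e_S (put 1 outside S), a fragment of an FI♯-structure. Möbius inversion
over the e_S yields the operators `proj`, which detect the part of a class supported exactly on S;
they separate vectors.

For a tableau T let a and b be the row sum and the signed column sum. The multiplicity of the
corresponding irreducible is dim ab·V_n, and also dim ba·V_n. Append n + 1 to the first row of T.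
The column sum is unchanged, and the row sum is multiplied by transpositions (k, n + 1) representing
cosets. Hence `stabMap`, the sum of these transpositions composed with φ, carries ab·V_n into its
analogue for n + 1. It is injective for every n, because proj_S ∘ res ∘ stabMap is a positive
multiple of proj_S. This gives monotonicity (`span_contains`) and one inequality of multiplicities.

The other inequality needs a degree bound: proj_S = 0 whenever |S| > q. The support of a
column-antisymmetric vector misses at most one box of each column. So |λ| ≤ |S| ≤ q, and if n + 1 >
2q then some box outside S lies alone in its column. Symmetry in the first row exchanges that box
with n + 1, which makes `res` injective on ba·V_{n+1} (`res_injective_on_range`). The degree bound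
also expresses each vector of V_{n+1} through classes missing a coordinate, which gives surjectivity
(`spanImage_top`).

The degree bound comes from growth rather than from a Künneth formula. If proj_S ≠ 0 with |S| = k,
then φ and symmetry force dim V_m ≥ choose(m, k) for all large m, so it suffices that dim V_m =
O(m^q). Dualizing a finite type resolution of ℤ into ℚ gives a coresolution of ℚ by summands of
Fun(G, ℚ)^r. By Shapiro's lemma H^i(G^{n+1}; Fun(G, ℚ)) = H^i(G^n; ℚ). Dimension shifting then
bounds dim H^{i+1}(G^{n+1}) by dim H^{i+1}(G^n) plus a fixed combination of lower cohomology of G^n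
(`finrank_trivial_succ`). Since the top term has coefficient 1, induction gives a polynomial bound
of degree q. -/

noncomputable section

namespace RepStab

/-! ### Modules generated by a primitive quasi-idempotent -/

/-- `c` is a nonzero multiple of a primitive idempotent whose corner ring is `ℚ`. -/
structure IsPrimitiveQuasiIdempotent {R : Type*} [Ring R] [Algebra ℚ R] (c : R) (N : ℚ) : Prop where
  ne_zero : N ≠ 0
  mul_self : c * c = N • c
  corner : ∀ x : R, ∃ α : ℚ, c * x * c = α • c

section QuasiIdempotent

variable {R : Type*} [Ring R]

/-- Each y x squares to zero, so 1 + y x has inverse 1 - y x and x lies in the Jacobson radical,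
which vanishes. -/
theorem eq_zero_of_mul_mul_self_eq_zero [IsSemisimpleRing R] {x : R}
    (hx : ∀ r : R, x * r * x = 0) : x = 0 := by
  have h : x ∈ (⊥ : Ideal R).jacobson := by
    rw [Ideal.mem_jacobson_iff]
    refine fun y => ⟨1 - y * x, ?_⟩
    rw [Ideal.mem_bot]
    have h1 : y * (x * y * x) = 0 := by rw [hx, mul_zero]
    have h2 : (1 - y * x) * y * x + (1 - y * x) - 1 = -(y * (x * y * x)) := by noncomm_ring
    rw [h2, h1, neg_zero]
  rw [Ideal.jacobson_bot, IsSemisimpleRing.jacobson_eq_bot] at h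
  simpa using h

variable [Algebra ℚ R] {c : R} {N : ℚ}
variable {M : Type*} [AddCommGroup M] [Module ℚ M] [Module R M] [IsScalarTower ℚ R M]

namespace IsPrimitiveQuasiIdempotent

theorem smul_smul_eq (hc : IsPrimitiveQuasiIdempotent c N) (x : M) :
    c • (c • x) = N • (c • x) := by
  rw [← mul_smul, hc.mul_self, smul_assoc]

/-- The vectors in `c M` given by the generators of the summands of an embedded `(R c)^k`. -/
theorem linearIndependent_of_injective (hc : IsPrimitiveQuasiIdempotent c N) (h0 : c ≠ 0) {k : ℕ}
    (f : (Fin k → Submodule.span R {c}) →ₗ[R] M) (hf : Function.Injective f) :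
    ∃ v : Fin k → M, LinearIndependent ℚ v ∧ (∀ i, c • v i = N • v i) ∧
      ∀ i, v i ∈ LinearMap.range f := by
  let g : Submodule.span R {c} := ⟨c, Submodule.mem_span_singleton_self c⟩
  refine ⟨fun i => f (Pi.single i g), ?_, fun i => ?_, fun i => ⟨_, rfl⟩⟩
  · rw [Fintype.linearIndependent_iff]
    intro t ht i
    have h1 : f (∑ i, (algebraMap ℚ R (t i)) • Pi.single i g) = 0 := by
      rw [map_sum, ← ht]
      refine Finset.sum_congr rfl fun i _ => ?_
      rw [map_smul, algebraMap_smul]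
    have h2 := congrFun (hf (h1.trans (map_zero f).symm)) i
    rw [Finset.sum_apply, Finset.sum_eq_single i] at h2
    · have h3 := congrArg Subtype.val h2
      simp only [Pi.smul_apply, Pi.single_eq_same, Pi.zero_apply, g,
        ZeroMemClass.coe_zero, algebraMap_smul] at h3
      exact (smul_eq_zero.1 h3).resolve_right h0
    · intro j _ hj
      simp [Pi.single_eq_of_ne (Ne.symm hj)]
    · simp
  · have h1 : c • (Pi.single i g : Fin k → Submodule.span R {c}) =
        algebraMap ℚ R N • Pi.single i g := by
      rw [← Pi.single_smul, ← Pi.single_smul]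
      congr 1
      apply Subtype.ext
      simp [g, hc.mul_self, Algebra.smul_def]
    rw [← map_smul, h1, map_smul, algebraMap_smul]

/-- Linearly independent vectors in `c M` generate a copy of `(R c)^k`. -/
theorem exists_injective_of_linearIndependent [IsSemisimpleRing R]
    (hc : IsPrimitiveQuasiIdempotent c N) {k : ℕ}
    (v : Fin k → M) (hv : LinearIndependent ℚ v) (hcv : ∀ i, c • v i = N • v i) :
    ∃ f : (Fin k → Submodule.span R {c}) →ₗ[R] M, Function.Injective f ∧
      LinearMap.range f ≤ Submodule.span R (Set.range v) := by
  let f : (Fin k → Submodule.span R {c}) →ₗ[R] M :=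
    ∑ i, (LinearMap.toSpanSingleton R M (v i)) ∘ₗ (Submodule.span R {c}).subtype ∘ₗ LinearMap.proj i
  have hf : ∀ s, f s = ∑ i, (s i : R) • v i := fun s => by simp [f]
  refine ⟨f, ?_, ?_⟩
  · rw [← LinearMap.ker_eq_bot, LinearMap.ker_eq_bot']
    intro s hs
    rw [hf] at hs
    choose t ht using fun i => Submodule.mem_span_singleton.1 (s i).2
    choose α hα using fun (r : R) i => hc.corner (r * t i)
    have hrs : ∀ r i, c * r * (s i : R) = α r i • c := fun r i => by
      rw [← hα, ← ht, smul_eq_mul, mul_assoc, mul_assoc, mul_assoc]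
    -- Multiplying the relation ∑ sᵢ vᵢ = 0 by c r turns its coefficients into scalars, because the
    -- corner ring is ℚ. Independence kills them, and then sᵢ R sᵢ = 0.
    have key : ∀ r i, α r i = 0 := by
      intro r
      have h1 : ∑ i, (N * α r i) • v i = 0 := by
        have h2 := congrArg (fun x => (c * r) • x) hs
        simp only [Finset.smul_sum, smul_zero, ← mul_smul, hrs] at h2
        rw [← h2]
        refine Finset.sum_congr rfl fun i _ => ?_
        rw [smul_assoc, hcv, ← mul_smul, mul_comm]
      intro i
      exact (mul_eq_zero.1 (Fintype.linearIndependent_iff.1 hv _ h1 i)).resolve_left hc.ne_zero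
    funext i
    apply Subtype.ext
    apply eq_zero_of_mul_mul_self_eq_zero
    intro r
    rw [← ht i, smul_eq_mul]
    calc t i * c * r * (t i * c) = t i * (c * r * (t i * c)) := by noncomm_ring
      _ = 0 := by
        have := hrs r i
        rw [← ht i, smul_eq_mul, key, zero_smul] at this
        rw [this, mul_zero]
  · rintro _ ⟨s, rfl⟩
    rw [hf]
    exact Submodule.sum_mem _ fun i _ => Submodule.smul_mem _ _ (Submodule.subset_span ⟨i, rfl⟩)

variable (M) in
-- Homomorphisms R c → M correspond to vectors of c M, and embeddings of k copies to k independent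
-- vectors. The admissible k therefore form exactly an initial segment ending at dim c M, so the
-- supremum is attained.
theorem multiplicity_eq_finrank [IsSemisimpleRing R] [FiniteDimensional ℚ M]
    (hc : IsPrimitiveQuasiIdempotent c N) (h0 : c ≠ 0) :
    multiplicity R (Submodule.span R {c}) M =
      Module.finrank ℚ (LinearMap.range (Algebra.lsmul ℚ ℚ M c)) := by
  have key : {k : ℕ | ∃ f : (Fin k → Submodule.span R {c}) →ₗ[R] M, Function.Injective f} =
      Set.Iic (Module.finrank ℚ (LinearMap.range (Algebra.lsmul ℚ ℚ M c))) := by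
    ext k
    constructor
    · rintro ⟨f, hf⟩
      obtain ⟨v, hv, hcv, -⟩ := hc.linearIndependent_of_injective h0 f hf
      have hmem : ∀ i, v i ∈ LinearMap.range (Algebra.lsmul ℚ ℚ M c) := fun i =>
        ⟨N⁻¹ • v i, by
          change c • (N⁻¹ • v i) = v i
          rw [smul_algebra_smul_comm, hcv, smul_smul, inv_mul_cancel₀ hc.ne_zero, one_smul]⟩
      have h2 : LinearIndependent ℚ
          (fun i => (⟨v i, hmem i⟩ : LinearMap.range (Algebra.lsmul ℚ ℚ M c))) :=
        LinearIndependent.of_comp (Submodule.subtype _) hv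
      simpa using h2.fintype_card_le_finrank
    · intro hk
      let b := Module.finBasis ℚ (LinearMap.range (Algebra.lsmul ℚ ℚ M c))
      let v : Fin k → M := fun i => (b (Fin.castLE hk i) : M)
      have hv : LinearIndependent ℚ v :=
        (b.linearIndependent.comp _ (Fin.castLE_injective hk)).map' (Submodule.subtype _)
          (Submodule.ker_subtype _)
      have hcv : ∀ i, c • v i = N • v i := by
        intro i
        obtain ⟨x, hx⟩ := (b (Fin.castLE hk i)).2
        change c • ((b (Fin.castLE hk i)) : M) = N • ((b (Fin.castLE hk i)) : M)
        rw [← hx, Algebra.lsmul_coe]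
        exact hc.smul_smul_eq x
      obtain ⟨f, hf, -⟩ := hc.exists_injective_of_linearIndependent v hv hcv
      exact ⟨f, hf⟩
  rw [multiplicity, key]
  exact csSup_Iic

end IsPrimitiveQuasiIdempotent

end QuasiIdempotent

section

open Equiv

/-! ### Young symmetrizers -/

section Symmetrizers

variable {n : ℕ}

/-- The permutations preserving the fibres of `f`. -/
def fiberPerms (f : Fin n → ℕ) : Finset (Perm (Fin n)) :=
  Finset.univ.filter fun σ => ∀ i, f (σ i) = f i

/-- The sum of the permutations preserving the fibres of `f`. -/
def symmSum (f : Fin n → ℕ) : SymAlg n := ∑ σ ∈ fiberPerms f, MonoidAlgebra.single σ (1 : ℚ)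

/-- The signed sum of the permutations preserving the fibres of `f`. -/
def altSum (f : Fin n → ℕ) : SymAlg n :=
  ∑ σ ∈ fiberPerms f, MonoidAlgebra.single σ (((Perm.sign σ : ℤ) : ℚ))

theorem mem_fiberPerms {f : Fin n → ℕ} {σ : Perm (Fin n)} :
    σ ∈ fiberPerms f ↔ ∀ i, f (σ i) = f i := by simp [fiberPerms]

theorem one_mem_fiberPerms (f : Fin n → ℕ) : (1 : Perm (Fin n)) ∈ fiberPerms f :=
  mem_fiberPerms.2 fun _ => rfl

theorem mul_mem_fiberPerms {f : Fin n → ℕ} {σ τ : Perm (Fin n)} (hσ : σ ∈ fiberPerms f)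
    (hτ : τ ∈ fiberPerms f) : σ * τ ∈ fiberPerms f := by
  rw [mem_fiberPerms] at *
  intro i
  rw [Perm.mul_apply, hσ, hτ]

theorem inv_mem_fiberPerms {f : Fin n → ℕ} {σ : Perm (Fin n)} (hσ : σ ∈ fiberPerms f) :
    σ⁻¹ ∈ fiberPerms f := by
  rw [mem_fiberPerms] at *
  intro i
  have := hσ (σ⁻¹ i)
  simpa using this.symm

theorem swap_mem_fiberPerms {f : Fin n → ℕ} {i j : Fin n} (h : f i = f j) :
    swap i j ∈ fiberPerms f := by
  rw [mem_fiberPerms]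
  intro k
  rcases eq_or_ne k i with rfl | hi
  · rw [swap_apply_left, h]
  · rcases eq_or_ne k j with rfl | hj
    · rw [swap_apply_right, h]
    · rw [swap_apply_of_ne_of_ne hi hj]

theorem sum_fiberPerms_mul_left {A : Type*} [AddCommMonoid A] {f : Fin n → ℕ} {σ : Perm (Fin n)}
    (hσ : σ ∈ fiberPerms f) (F : Perm (Fin n) → A) :
    ∑ τ ∈ fiberPerms f, F (σ * τ) = ∑ τ ∈ fiberPerms f, F τ :=
  Finset.sum_bij' (fun τ _ => σ * τ) (fun τ _ => σ⁻¹ * τ)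
    (fun _ hτ => mul_mem_fiberPerms hσ hτ)
    (fun _ hτ => mul_mem_fiberPerms (inv_mem_fiberPerms hσ) hτ)
    (fun _ _ => by group) (fun _ _ => by group) (fun _ _ => rfl)

theorem sum_fiberPerms_mul_right {A : Type*} [AddCommMonoid A] {f : Fin n → ℕ} {σ : Perm (Fin n)}
    (hσ : σ ∈ fiberPerms f) (F : Perm (Fin n) → A) :
    ∑ τ ∈ fiberPerms f, F (τ * σ) = ∑ τ ∈ fiberPerms f, F τ :=
  Finset.sum_bij' (fun τ _ => τ * σ) (fun τ _ => τ * σ⁻¹)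
    (fun _ hτ => mul_mem_fiberPerms hτ hσ)
    (fun _ hτ => mul_mem_fiberPerms hτ (inv_mem_fiberPerms hσ))
    (fun _ _ => by group) (fun _ _ => by group) (fun _ _ => rfl)

theorem single_mul_symmSum {f : Fin n → ℕ} {σ : Perm (Fin n)} (hσ : σ ∈ fiberPerms f) :
    MonoidAlgebra.single σ (1 : ℚ) * symmSum f = symmSum f := by
  rw [symmSum, Finset.mul_sum]
  simp only [MonoidAlgebra.single_mul_single, one_mul]
  exact sum_fiberPerms_mul_left hσ fun τ => MonoidAlgebra.single τ (1 : ℚ)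

theorem symmSum_mul_single {f : Fin n → ℕ} {σ : Perm (Fin n)} (hσ : σ ∈ fiberPerms f) :
    symmSum f * MonoidAlgebra.single σ (1 : ℚ) = symmSum f := by
  rw [symmSum, Finset.sum_mul]
  simp only [MonoidAlgebra.single_mul_single, one_mul]
  exact sum_fiberPerms_mul_right hσ fun τ => MonoidAlgebra.single τ (1 : ℚ)

theorem sign_mul_sign_self (σ : Perm (Fin n)) :
    ((Perm.sign σ : ℤ) : ℚ) * ((Perm.sign σ : ℤ) : ℚ) = 1 := by
  rcases Int.units_eq_one_or (Perm.sign σ) with h | h <;> simp [h]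

theorem single_mul_altSum {f : Fin n → ℕ} {σ : Perm (Fin n)} (hσ : σ ∈ fiberPerms f) :
    MonoidAlgebra.single σ (1 : ℚ) * altSum f = ((Perm.sign σ : ℤ) : ℚ) • altSum f := by
  rw [altSum, Finset.mul_sum, Finset.smul_sum,
    ← sum_fiberPerms_mul_left hσ fun τ => ((Perm.sign σ : ℤ) : ℚ) •
      MonoidAlgebra.single τ (((Perm.sign τ : ℤ) : ℚ))]
  refine Finset.sum_congr rfl fun τ _ => ?_
  rw [MonoidAlgebra.single_mul_single, one_mul, MonoidAlgebra.smul_single, Perm.sign_mul,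
    Units.val_mul, Int.cast_mul, smul_eq_mul, ← mul_assoc, sign_mul_sign_self, one_mul]

theorem conj_symmSum (f : Fin n → ℕ) (σ : Perm (Fin n)) :
    MonoidAlgebra.single σ (1 : ℚ) * symmSum f * MonoidAlgebra.single σ⁻¹ (1 : ℚ) =
      symmSum (fun i => f (σ⁻¹ i)) := by
  rw [symmSum, symmSum, Finset.mul_sum, Finset.sum_mul]
  refine Finset.sum_bij' (fun τ _ => σ * τ * σ⁻¹) (fun τ _ => σ⁻¹ * τ * σ) ?_ ?_
    (fun _ _ => by group) (fun _ _ => by group) ?_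
  · intro τ hτ
    rw [mem_fiberPerms] at *
    intro i
    simp [hτ]
  · intro τ hτ
    rw [mem_fiberPerms] at *
    intro i
    simpa using hτ (σ i)
  · intro τ _
    simp [MonoidAlgebra.single_mul_single]

theorem conj_altSum (f : Fin n → ℕ) (σ : Perm (Fin n)) :
    MonoidAlgebra.single σ (1 : ℚ) * altSum f * MonoidAlgebra.single σ⁻¹ (1 : ℚ) =
      altSum (fun i => f (σ⁻¹ i)) := by
  rw [altSum, altSum, Finset.mul_sum, Finset.sum_mul]
  refine Finset.sum_bij' (fun τ _ => σ * τ * σ⁻¹) (fun τ _ => σ⁻¹ * τ * σ) ?_ ?_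
    (fun _ _ => by group) (fun _ _ => by group) ?_
  · intro τ hτ
    rw [mem_fiberPerms] at *
    intro i
    simp [hτ]
  · intro τ hτ
    rw [mem_fiberPerms] at *
    intro i
    simpa using hτ (σ i)
  · intro τ _
    have := sign_mul_sign_self σ
    simp only [MonoidAlgebra.single_mul_single, Perm.sign_mul, Perm.sign_inv, Units.val_mul,
      Int.cast_mul, one_mul, mul_one]
    rw [mul_comm, ← mul_assoc, this, one_mul]

end Symmetrizers

/-! ### Tableaux -/

/-- The functions `r`, `c` are the row and column functions of a numbering of the boxes of `μ`. -/
structure IsTableau {n : ℕ} (μ : YoungDiagram) (r c : Fin n → ℕ) : Prop where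
  injective : ∀ i j, r i = r j → c i = c j → i = j
  mem_iff : ∀ x : ℕ × ℕ, x ∈ μ ↔ ∃ i, (r i, c i) = x

namespace IsTableau

variable {n : ℕ} {μ : YoungDiagram} {r c : Fin n → ℕ}

theorem image_eq (h : IsTableau μ r c) :
    Finset.univ.image (fun i => (r i, c i)) = μ.cells := by
  ext x
  rw [YoungDiagram.mem_cells, h.mem_iff]
  simp

theorem sum_eq (h : IsTableau μ r c) {A : Type*} [AddCommMonoid A] (F : ℕ → ℕ → A) :
    ∑ i, F (r i) (c i) = ∑ x ∈ μ.cells, F x.1 x.2 := by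
  rw [← h.image_eq, Finset.sum_image]
  intro i _ j _ hij
  simp only [Prod.mk.injEq] at hij
  exact h.injective i j hij.1 hij.2

theorem card_eq (h : IsTableau μ r c) : μ.cells.card = n := by
  have := h.sum_eq fun _ _ => 1
  simpa using this.symm

/-- If the rows of a tableau meet the columns of a permuted tableau in at most one point,
then the boxes so obtained are those of `μ`. -/
theorem mem_of_transversal (h : IsTableau μ r c) (σ : Perm (Fin n))
    (hσ : ∀ i j, r i = r j → c (σ⁻¹ i) = c (σ⁻¹ j) → i = j) (i : Fin n) :
    (r i, c (σ⁻¹ i)) ∈ μ := by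
  classical
  set F : Finset (ℕ × ℕ) := Finset.univ.image fun i => (r i, c (σ⁻¹ i)) with hF
  have hinj : Set.InjOn (fun i => (r i, c (σ⁻¹ i))) (Finset.univ : Finset (Fin n)) := by
    intro i _ j _ hij
    simp only [Prod.mk.injEq] at hij
    exact hσ i j hij.1 hij.2
  have hcard : F.card = μ.cells.card := by
    rw [hF, Finset.card_image_of_injOn hinj, h.card_eq, Finset.card_univ, Fintype.card_fin]
  -- The weight is negative exactly on the boxes of `μ`. Being a function of the row plus a function
  -- of the column, it has the same total over `F` as over `μ`, since σ only permutes the columns.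
  -- Equal totals force `μ ⊆ F`: boxes of `F` outside `μ` weigh at least 0, missing boxes of `μ`
  -- less than 0.
  let w : ℕ × ℕ → ℤ := fun x => (x.1 : ℤ) - μ.colLen x.2
  have hsum : ∑ x ∈ F, w x = ∑ x ∈ μ.cells, w x := by
    rw [hF, Finset.sum_image hinj, ← h.sum_eq fun a b => (a : ℤ) - μ.colLen b]
    simp only [w, Finset.sum_sub_distrib]
    congr 1
    exact Equiv.sum_comp σ⁻¹ fun i => (μ.colLen (c i) : ℤ)
  have hmem : ∀ x : ℕ × ℕ, x ∈ μ.cells ↔ w x < 0 := by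
    rintro ⟨a, b⟩
    rw [YoungDiagram.mem_cells, YoungDiagram.mem_iff_lt_colLen]
    simp only [w]
    omega
  have h1 := Finset.sum_sdiff_sub_sum_sdiff (s₁ := F) (s₂ := μ.cells) (f := w)
  have hpos : 0 ≤ ∑ x ∈ F \ μ.cells, w x := Finset.sum_nonneg fun x hx => by
    have := (Finset.mem_sdiff.1 hx).2
    rw [hmem] at this
    omega
  have hsub : μ.cells \ F = ∅ := by
    by_contra hne
    have hneg : ∑ x ∈ μ.cells \ F, w x < 0 :=
      Finset.sum_neg (fun x hx => (hmem x).1 (Finset.mem_sdiff.1 hx).1)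
        (Finset.nonempty_iff_ne_empty.2 hne)
    omega
  have hFe : μ.cells = F :=
    Finset.eq_of_subset_of_card_le (Finset.sdiff_eq_empty_iff_subset.1 hsub) hcard.le
  rw [← YoungDiagram.mem_cells, hFe, hF]
  exact Finset.mem_image_of_mem _ (Finset.mem_univ i)

/-- Let κ(i) be the number in the box (r i, c (σ⁻¹ i)), which lies in `μ`. Then κ preserves rows, κσ
preserves columns, and σ = κ⁻¹(κσ). -/
theorem exists_mul_eq_of_transversal (h : IsTableau μ r c) (σ : Perm (Fin n))
    (hσ : ∀ i j, r i = r j → c (σ⁻¹ i) = c (σ⁻¹ j) → i = j) :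
    ∃ p ∈ fiberPerms r, ∃ q ∈ fiberPerms c, σ = p * q := by
  choose k hk using fun i => (h.mem_iff _).1 (h.mem_of_transversal σ hσ i)
  simp only [Prod.mk.injEq] at hk
  have hkinj : Function.Injective k := fun i j hij =>
    hσ i j (by rw [← (hk i).1, ← (hk j).1, hij]) (by rw [← (hk i).2, ← (hk j).2, hij])
  let κ : Perm (Fin n) := Equiv.ofBijective k (Finite.injective_iff_bijective.1 hkinj)
  have hκ : ∀ i, κ i = k i := fun _ => rfl
  refine ⟨κ⁻¹, inv_mem_fiberPerms (mem_fiberPerms.2 fun i => by rw [hκ, (hk i).1]), κ * σ,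
    mem_fiberPerms.2 fun i => ?_, by group⟩
  rw [Perm.mul_apply, hκ, (hk _).2]
  simp

/-- If σ = pq with p a row and q a column permutation, both are absorbed, up to the sign of q.
Otherwise two points of one row have their σ⁻¹-images in one column; their transposition is absorbed
on the left and gives -1 on the right, so the product is its own negative. -/
theorem symmSum_mul_single_mul_altSum (h : IsTableau μ r c) (σ : Perm (Fin n)) :
    ∃ α : ℚ, symmSum r * MonoidAlgebra.single σ (1 : ℚ) * altSum c =
      α • (symmSum r * altSum c) := by
  by_cases hσ : ∀ i j, r i = r j → c (σ⁻¹ i) = c (σ⁻¹ j) → i = j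
  · obtain ⟨p, hp, q, hq, rfl⟩ := h.exists_mul_eq_of_transversal σ hσ
    refine ⟨((Perm.sign q : ℤ) : ℚ), ?_⟩
    have : MonoidAlgebra.single (p * q) (1 : ℚ) =
        MonoidAlgebra.single p (1 : ℚ) * MonoidAlgebra.single q (1 : ℚ) := by
      rw [MonoidAlgebra.single_mul_single, one_mul]
    rw [this, ← mul_assoc, symmSum_mul_single hp, mul_assoc, single_mul_altSum hq, mul_smul_comm]
  · push Not at hσ
    obtain ⟨i, j, hr, hc, hij⟩ := hσ
    refine ⟨0, ?_⟩
    rw [zero_smul]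
    have h1 : MonoidAlgebra.single (swap i j) (1 : ℚ) * MonoidAlgebra.single σ (1 : ℚ) =
        MonoidAlgebra.single σ (1 : ℚ) *
          MonoidAlgebra.single (swap (σ⁻¹ i) (σ⁻¹ j)) (1 : ℚ) := by
      rw [MonoidAlgebra.single_mul_single, MonoidAlgebra.single_mul_single, swap_mul_eq_mul_swap]
    have h2 : symmSum r * MonoidAlgebra.single σ (1 : ℚ) * altSum c =
        -(symmSum r * MonoidAlgebra.single σ (1 : ℚ) * altSum c) := by
      conv_lhs => rw [← symmSum_mul_single (swap_mem_fiberPerms hr), mul_assoc (symmSum r), h1,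
        mul_assoc, mul_assoc, single_mul_altSum (swap_mem_fiberPerms hc)]
      rw [Perm.sign_swap (fun e => hij (σ⁻¹.injective e))]
      simp [mul_assoc]
    have h3 : (2 : ℚ) • (symmSum r * MonoidAlgebra.single σ (1 : ℚ) * altSum c) = 0 := by
      rw [two_smul]
      nth_rewrite 1 [h2]
      exact neg_add_cancel _
    exact (smul_eq_zero.1 h3).resolve_left two_ne_zero

theorem symmSum_mul_mul_altSum (h : IsTableau μ r c) (x : SymAlg n) :
    ∃ α : ℚ, symmSum r * x * altSum c = α • (symmSum r * altSum c) := by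
  induction x using MonoidAlgebra.induction_on with
  | of σ => exact h.symmSum_mul_single_mul_altSum σ
  | add x y hx hy =>
    obtain ⟨α, hα⟩ := hx
    obtain ⟨β, hβ⟩ := hy
    exact ⟨α + β, by rw [mul_add, add_mul, hα, hβ, add_smul]⟩
  | smul t x hx =>
    obtain ⟨α, hα⟩ := hx
    exact ⟨t * α, by rw [mul_smul_comm, smul_mul_assoc, hα, mul_smul]⟩

/-- The coefficient at 1 is a trace; this is what excludes a nilpotent Young symmetrizer below. -/
theorem coeff_one_mul_comm (x y : SymAlg n) : (x * y).coeff 1 = (y * x).coeff 1 := by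
  induction x using MonoidAlgebra.induction_on with
  | of σ =>
    induction y using MonoidAlgebra.induction_on with
    | of τ =>
      simp only [MonoidAlgebra.of_apply, MonoidAlgebra.single_mul_single, MonoidAlgebra.coeff_single,
        Finsupp.single_apply, mul_eq_one_iff_eq_inv]
      congr 1
      rw [eq_iff_iff]
      exact ⟨fun e => by rw [e, inv_inv], fun e => by rw [e, inv_inv]⟩
    | add y z hy hz => simp_all [mul_add, add_mul]
    | smul t y hy => simp_all
  | add x z hx hz => simp_all [mul_add, add_mul]
  | smul t x hx => simp_all

/-- A permutation preserving all rows and all columns is trivial, so only 1 · 1 contributes. -/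
theorem coeff_one_symmSum_mul_altSum (h : IsTableau μ r c) :
    (symmSum r * altSum c).coeff 1 = 1 := by
  rw [symmSum, altSum, Finset.sum_mul_sum]
  simp only [MonoidAlgebra.single_mul_single, one_mul, MonoidAlgebra.coeff_sum,
    MonoidAlgebra.coeff_single, Finsupp.finsetSum_apply]
  rw [Finset.sum_eq_single 1, Finset.sum_eq_single 1]
  · simp
  · intro τ _ hτ
    rw [one_mul, Finsupp.single_eq_of_ne hτ.symm]
  · exact fun e => absurd (one_mem_fiberPerms c) e
  · intro σ hσ hσ1
    refine Finset.sum_eq_zero fun τ hτ => ?_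
    rw [Finsupp.single_eq_of_ne]
    intro e
    have e' : τ = σ⁻¹ := (mul_eq_one_iff_inv_eq.1 e.symm).symm
    subst e'
    apply hσ1
    ext1 i
    refine h.injective _ _ (mem_fiberPerms.1 hσ i) ?_
    simpa using (mem_fiberPerms.1 hτ (σ i)).symm
  · exact fun e => absurd (one_mem_fiberPerms r) e

theorem symmSum_mul_altSum_ne_zero (h : IsTableau μ r c) : symmSum r * altSum c ≠ 0 := by
  intro e
  have := h.coeff_one_symmSum_mul_altSum
  rw [e] at this
  simp at this

/-- With a, b the two sums, (ab)x(ab) = a(bxa)b is a multiple of ab. The value of N is not computed,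
only shown nonzero: if (ab)² = 0, the trace makes every (ab)x(ab) vanish, so ab = 0 by
semisimplicity. -/
theorem isPrimitiveQuasiIdempotent (h : IsTableau μ r c) :
    ∃ N : ℚ, IsPrimitiveQuasiIdempotent (symmSum r * altSum c) N := by
  obtain ⟨N, hN⟩ := h.symmSum_mul_mul_altSum (altSum c * symmSum r)
  have hcorner : ∀ x : SymAlg n, ∃ α : ℚ,
      symmSum r * altSum c * x * (symmSum r * altSum c) = α • (symmSum r * altSum c) := by
    intro x
    obtain ⟨α, hα⟩ := h.symmSum_mul_mul_altSum (altSum c * x * symmSum r)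
    exact ⟨α, by rw [← hα]; noncomm_ring⟩
  have hmul : symmSum r * altSum c * (symmSum r * altSum c) = N • (symmSum r * altSum c) := by
    rw [← hN]; noncomm_ring
  refine ⟨N, ?_, hmul, hcorner⟩
  rintro rfl
  rw [zero_smul] at hmul
  refine h.symmSum_mul_altSum_ne_zero (eq_zero_of_mul_mul_self_eq_zero fun x => ?_)
  obtain ⟨α, hα⟩ := hcorner x
  -- The trace of (ab)x(ab) is α on one side and the trace of x(ab)² = 0 on the other.
  have h1 := congrArg (fun y => MonoidAlgebra.coeff y 1) hα
  rw [mul_assoc, coeff_one_mul_comm, mul_assoc x, hmul] at h1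
  simp only [mul_zero, MonoidAlgebra.coeff_zero, MonoidAlgebra.coeff_smul, Finsupp.coe_zero,
    Pi.zero_apply, Finsupp.smul_apply, h.coeff_one_symmSum_mul_altSum, smul_eq_mul, mul_one] at h1
  rw [hα, ← h1, zero_smul]

end IsTableau

end

section

open Equiv

/-! ### Independence of the numbering, and tableaux of padded shape -/

namespace IsTableau

variable {n : ℕ} {μ : YoungDiagram} {r c : Fin n → ℕ}

theorem of_numbering (μ : YoungDiagram) (h : μ.card = n) :
    IsTableau μ (rowOf μ h) (colOf μ h) where
  injective i j hr hc := (numbering μ h).symm.injective (Subtype.ext (Prod.ext hr hc))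
  mem_iff x := by
    constructor
    · intro hx
      exact ⟨numbering μ h ⟨x, hx⟩, by simp [rowOf, colOf]⟩
    · rintro ⟨i, rfl⟩
      exact ((numbering μ h).symm i).2

/-- Any two tableaux of the same shape differ by a permutation. -/
theorem exists_perm (h : IsTableau μ r c) {r' c' : Fin n → ℕ} (h' : IsTableau μ r' c') :
    ∃ σ : Perm (Fin n), ∀ i, r' i = r (σ⁻¹ i) ∧ c' i = c (σ⁻¹ i) := by
  choose k hk using fun i => (h.mem_iff (r' i, c' i)).1 ((h'.mem_iff _).2 ⟨i, rfl⟩)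
  simp only [Prod.mk.injEq] at hk
  have hinj : Function.Injective k := fun i j e =>
    h'.injective i j (by rw [← (hk i).1, ← (hk j).1, e]) (by rw [← (hk i).2, ← (hk j).2, e])
  refine ⟨(Equiv.ofBijective k (Finite.injective_iff_bijective.1 hinj))⁻¹, fun i => ?_⟩
  rw [inv_inv]
  exact ⟨(hk i).1.symm, (hk i).2.symm⟩

/-- `irrep` fixes an arbitrary numbering of the boxes; conjugacy allows any tableau instead, in
particular one obtained by appending a box. -/
theorem exists_conj (h : IsTableau μ r c) {r' c' : Fin n → ℕ} (h' : IsTableau μ r' c') :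
    ∃ σ : Perm (Fin n), symmSum r' * altSum c' =
      MonoidAlgebra.single σ (1 : ℚ) * (symmSum r * altSum c) *
        MonoidAlgebra.single σ⁻¹ (1 : ℚ) := by
  obtain ⟨σ, hσ⟩ := h.exists_perm h'
  refine ⟨σ, ?_⟩
  rw [funext fun i => (hσ i).1, funext fun i => (hσ i).2, ← conj_symmSum, ← conj_altSum]
  have : MonoidAlgebra.single σ⁻¹ (1 : ℚ) * MonoidAlgebra.single σ (1 : ℚ) = 1 := by
    rw [MonoidAlgebra.single_mul_single, inv_mul_cancel, one_mul]; rfl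
  calc _ = MonoidAlgebra.single σ (1 : ℚ) * symmSum r *
        (MonoidAlgebra.single σ⁻¹ (1 : ℚ) * MonoidAlgebra.single σ (1 : ℚ)) * altSum c *
          MonoidAlgebra.single σ⁻¹ (1 : ℚ) := by noncomm_ring
    _ = _ := by rw [this]; noncomm_ring

end IsTableau

theorem mem_padded {l : YoungDiagram} {n : ℕ} (h : PaddedDefined l n) (i j : ℕ) :
    (i, j) ∈ padded l n h ↔ (i = 0 ∧ j < n - l.card) ∨ ∃ i', i = i' + 1 ∧ (i', j) ∈ l := by
  have h1 : YoungDiagram.cellsOfRowLens l.rowLens = l.cells :=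
    congrArg YoungDiagram.cells (YoungDiagram.ofRowLens_to_rowLens_eq_self (μ := l))
  rw [← YoungDiagram.mem_cells]
  change (i, j) ∈ YoungDiagram.cellsOfRowLens ((n - l.card) :: l.rowLens) ↔ _
  rw [YoungDiagram.cellsOfRowLens, h1]
  simp only [Finset.mem_union, Finset.mem_product, Finset.mem_singleton, Finset.mem_range,
    Finset.mem_map, YoungDiagram.mem_cells]
  refine or_congr Iff.rfl ⟨?_, ?_⟩
  · rintro ⟨⟨a, b⟩, hx, e⟩
    simp at e
    obtain ⟨rfl, rfl⟩ := e
    exact ⟨a, rfl, hx⟩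
  · rintro ⟨a, rfl, hx⟩
    exact ⟨(a, j), hx, rfl⟩

namespace IsTableau

variable {n : ℕ} {l : YoungDiagram} {r c : Fin n → ℕ} {h : PaddedDefined l n}

theorem row_eq_zero_iff (hT : IsTableau (padded l n h) r c) {i : Fin n}
    (hi : l.rowLen 0 ≤ c i) : r i = 0 := by
  have := (hT.mem_iff _).2 ⟨i, rfl⟩
  rw [mem_padded] at this
  rcases this with ⟨h0, -⟩ | ⟨i', h0, h1⟩
  · exact h0
  · rw [YoungDiagram.mem_iff_lt_rowLen] at h1
    have := l.rowLen_anti 0 i' (Nat.zero_le _)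
    omega

/-- Rows of λ have length at most λ₁ ≤ n - |λ|. Hence column n - |λ| is empty and can receive the
new box alone. -/
theorem col_lt (hT : IsTableau (padded l n h) r c) (i : Fin n) : c i < n - l.card := by
  have := (hT.mem_iff _).2 ⟨i, rfl⟩
  rw [mem_padded] at this
  rcases this with ⟨-, h0⟩ | ⟨i', h0, h1⟩
  · exact h0
  · rw [YoungDiagram.mem_iff_lt_rowLen] at h1
    have := l.rowLen_anti 0 i' (Nat.zero_le _)
    have h' := h
    unfold PaddedDefined at h'
    omega

/-- A tableau of shape `λ[n]` extended by putting `n + 1` at the end of the first row. -/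
theorem snoc (hT : IsTableau (padded l n h) r c) :
    IsTableau (padded l (n + 1) h.succ) (Fin.snoc r 0 : Fin (n + 1) → ℕ)
      (Fin.snoc c (n - l.card) : Fin (n + 1) → ℕ) where
  injective i j := by
    induction i using Fin.lastCases with
    | last =>
      induction j using Fin.lastCases with
      | last => simp
      | cast j =>
        simp only [Fin.snoc_last, Fin.snoc_castSucc]
        intro _ e
        have := hT.col_lt j
        omega
    | cast i =>
      induction j using Fin.lastCases with
      | last =>
        simp only [Fin.snoc_last, Fin.snoc_castSucc]
        intro _ e
        have := hT.col_lt i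
        omega
      | cast j =>
        simp only [Fin.snoc_castSucc, Fin.castSucc_inj]
        exact hT.injective i j
  mem_iff := by
    rintro ⟨a, b⟩
    have hd := h
    unfold PaddedDefined at hd
    rw [Fin.exists_fin_succ']
    simp only [Fin.snoc_last, Fin.snoc_castSucc]
    rw [← hT.mem_iff, mem_padded, mem_padded, Prod.mk.injEq]
    have : n + 1 - l.card = n - l.card + 1 := by omega
    rw [this, Nat.lt_succ_iff_lt_or_eq, @eq_comm _ 0 a, @eq_comm _ _ b, or_right_comm, ← and_or_left]

end IsTableau

end

section

open Equiv

/-! ### Extending permutations by a fixed point -/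

section PermIncl

variable {n : ℕ}

@[simp]
theorem permIncl_castSucc (σ : Perm (Fin n)) (i : Fin n) :
    permIncl n σ i.castSucc = (σ i).castSucc :=
  Perm.viaEmbedding_apply σ Fin.castSuccEmb i

@[simp]
theorem permIncl_last (σ : Perm (Fin n)) : permIncl n σ (Fin.last n) = Fin.last n :=
  Perm.viaEmbedding_apply_of_notMem σ Fin.castSuccEmb _ (by
    rintro ⟨i, hi⟩
    exact (Fin.castSucc_lt_last i).ne hi)

theorem exists_permIncl_eq {τ : Perm (Fin (n + 1))} (hτ : τ (Fin.last n) = Fin.last n) :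
    ∃ σ, permIncl n σ = τ := by
  have hne : ∀ i : Fin n, τ i.castSucc ≠ Fin.last n := fun i e =>
    (Fin.castSucc_lt_last i).ne (τ.injective (e.trans hτ.symm))
  let k : Fin n → Fin n := fun i => (τ i.castSucc).castPred (hne i)
  have hk : ∀ i, (k i).castSucc = τ i.castSucc := fun i => Fin.castSucc_castPred _ _
  have hinj : Function.Injective k := fun i j e =>
    Fin.castSucc_injective n (τ.injective (by rw [← hk, ← hk, e]))
  refine ⟨Equiv.ofBijective k (Finite.injective_iff_bijective.1 hinj), ?_⟩
  ext1 i
  induction i using Fin.lastCases with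
  | last => rw [permIncl_last, hτ]
  | cast i => rw [permIncl_castSucc]; exact hk i

theorem permIncl_injective : Function.Injective (permIncl n) := by
  intro σ τ h
  ext1 i
  apply Fin.castSucc_injective n
  rw [← permIncl_castSucc, h, permIncl_castSucc]

theorem sign_permIncl (σ : Perm (Fin n)) : Perm.sign (permIncl n σ) = Perm.sign σ := by
  let _ : DecidablePred (· ∈ Set.range Fin.castSuccEmb.toFun) := fun (a : Fin (n + 1)) =>
    Classical.propDecidable (a ∈ Set.range Fin.castSuccEmb.toFun)
  exact Perm.sign_extendDomain σ _

theorem permIncl_mem_fiberPerms_snoc {f : Fin n → ℕ} {m : ℕ} {σ : Perm (Fin n)} :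
    permIncl n σ ∈ fiberPerms (Fin.snoc f m : Fin (n + 1) → ℕ) ↔ σ ∈ fiberPerms f := by
  rw [mem_fiberPerms, mem_fiberPerms, Fin.forall_fin_succ']
  simp

/-- The inclusion of group algebras induced by `S_n ↪ S_{n+1}`. -/
def algIncl (n : ℕ) : SymAlg n →ₐ[ℚ] SymAlg (n + 1) := MonoidAlgebra.mapDomainAlgHom ℚ ℚ (permIncl n)

theorem algIncl_single (σ : Perm (Fin n)) (t : ℚ) :
    algIncl n (MonoidAlgebra.single σ t) = MonoidAlgebra.single (permIncl n σ) t := by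
  simp [algIncl]

/-- The new point is alone in its column, so every column permutation of the larger tableau fixes
it. -/
theorem algIncl_altSum {c : Fin n → ℕ} {m : ℕ} (hm : ∀ i, c i ≠ m) :
    algIncl n (altSum c) = altSum (Fin.snoc c m : Fin (n + 1) → ℕ) := by
  rw [altSum, altSum, map_sum]
  refine Finset.sum_bij (fun σ _ => permIncl n σ) (fun σ hσ => permIncl_mem_fiberPerms_snoc.2 hσ)
    (fun _ _ _ _ e => permIncl_injective e) ?_ (fun σ _ => by rw [algIncl_single, sign_permIncl])
  intro τ hτ
  obtain ⟨σ, rfl⟩ := exists_permIncl_eq (τ := τ) (by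
    have := mem_fiberPerms.1 hτ (Fin.last n)
    rw [Fin.snoc_last] at this
    by_contra hne
    obtain ⟨i, hi⟩ := Fin.exists_castSucc_eq.2 hne
    rw [← hi, Fin.snoc_castSucc] at this
    exact hm i this)
  exact ⟨σ, permIncl_mem_fiberPerms_snoc.1 hτ, rfl⟩

/-- Coset decomposition of the row group of an extended tableau. -/
theorem symmSum_snoc (r : Fin n → ℕ) (m : ℕ) :
    symmSum (Fin.snoc r m : Fin (n + 1) → ℕ) =
      (∑ k ∈ Finset.univ.filter (fun k => (Fin.snoc r m : Fin (n + 1) → ℕ) k = m),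
        MonoidAlgebra.single (swap k (Fin.last n)) (1 : ℚ)) * algIncl n (symmSum r) := by
  rw [symmSum, symmSum, map_sum, Finset.sum_mul_sum, ← Finset.sum_product']
  simp only [algIncl_single, MonoidAlgebra.single_mul_single, mul_one]
  symm
  refine Finset.sum_bij (fun x _ => swap x.1 (Fin.last n) * permIncl n x.2) ?_ ?_ ?_ (fun _ _ => rfl)
  · rintro ⟨k, σ⟩ hx
    simp only [Finset.mem_product, Finset.mem_filter, Finset.mem_univ, true_and] at hx
    exact mul_mem_fiberPerms (swap_mem_fiberPerms (by rw [hx.1, Fin.snoc_last]))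
      (permIncl_mem_fiberPerms_snoc.2 hx.2)
  · rintro ⟨k, σ⟩ _ ⟨k', σ'⟩ _ e
    simp only at e
    have h1 : k = k' := by
      have := congrArg (fun τ : Perm (Fin (n + 1)) => τ (Fin.last n)) e
      simpa using this
    subst h1
    rw [permIncl_injective (mul_left_cancel e)]
  · intro τ hτ
    obtain ⟨σ, hσ⟩ := exists_permIncl_eq (τ := swap (τ (Fin.last n)) (Fin.last n) * τ) (by simp)
    have h1 := mem_fiberPerms.1 hτ (Fin.last n)
    rw [Fin.snoc_last] at h1
    refine ⟨(τ (Fin.last n), σ), ?_, ?_⟩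
    · simp only [Finset.mem_product, Finset.mem_filter, Finset.mem_univ, true_and]
      refine ⟨h1, (permIncl_mem_fiberPerms_snoc (m := m)).1 ?_⟩
      rw [hσ]
      exact mul_mem_fiberPerms (swap_mem_fiberPerms (by rw [h1, Fin.snoc_last])) hτ
    · simp only [hσ]
      rw [← mul_assoc, swap_mul_self, one_mul]

/-- The old row group embeds in the new one, each element being absorbed. Dividing by its order puts
a factor `symmSum r` in front of the new row sum. -/
theorem algIncl_symmSum_mul_symmSum_snoc (r : Fin n → ℕ) (m : ℕ) :
    algIncl n (symmSum r) * symmSum (Fin.snoc r m : Fin (n + 1) → ℕ) =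
      ((fiberPerms r).card : ℚ) • symmSum (Fin.snoc r m : Fin (n + 1) → ℕ) := by
  conv_lhs => rw [symmSum, map_sum, Finset.sum_mul]
  rw [Finset.sum_congr rfl fun σ hσ => by
    rw [algIncl_single, single_mul_symmSum (permIncl_mem_fiberPerms_snoc.2 hσ)]]
  rw [Finset.sum_const, ← Nat.cast_smul_eq_nsmul ℚ]

end PermIncl

/-! ### Consistent sequences with a compatible `FI♯`-structure -/

variable {V : ℕ → Type*} [∀ n, AddCommGroup (V n)] [∀ n, Module ℚ (V n)]

/-- A consistent sequence together with retractions `V (n + 1) → V n` and endomorphisms `e n S` which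
forget the coordinates outside `S`. -/
structure FISharp (ρ : ∀ n, Representation ℚ (Perm (Fin n)) (V n))
    (φ : ∀ n, V n →ₗ[ℚ] V (n + 1)) where
  /-- The retraction of `φ n`. -/
  res : ∀ n, V (n + 1) →ₗ[ℚ] V n
  /-- The endomorphism forgetting the coordinates outside `S`. -/
  e : ∀ n, Finset (Fin n) → Module.End ℚ (V n)
  consistent : ∀ n, IsConsistentAt ρ φ n
  e_univ : ∀ n (v : V n), e n Finset.univ v = v
  e_e : ∀ n (S T : Finset (Fin n)) (v : V n), e n S (e n T v) = e n (S ∩ T) v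
  ρ_e : ∀ n (σ : Perm (Fin n)) (S : Finset (Fin n)) (v : V n),
    ρ n σ (e n S v) = e n (S.map σ.toEmbedding) (ρ n σ v)
  ρ_e_of_fixed : ∀ n (σ : Perm (Fin n)) (S : Finset (Fin n)), (∀ i ∈ S, σ i = i) →
    ∀ v : V n, ρ n σ (e n S v) = e n S v
  res_ρ : ∀ n (σ : Perm (Fin n)) (v : V (n + 1)),
    res n (ρ (n + 1) (permIncl n σ) v) = ρ n σ (res n v)
  res_φ : ∀ n (v : V n), res n (φ n v) = v
  φ_res : ∀ n (v : V (n + 1)), φ n (res n v) = e (n + 1) (Finset.univ.erase (Fin.last n)) v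
  φ_e : ∀ n (S : Finset (Fin n)) (v : V n),
    φ n (e n S v) = e (n + 1) (S.map Fin.castSuccEmb) (φ n v)
  -- The composite erases coordinate k; for k = n + 1 the filter is everything and the composite is
  -- the identity.
  res_swap_φ : ∀ n (k : Fin (n + 1)) (v : V n), res n (ρ (n + 1) (swap k (Fin.last n)) (φ n v)) =
    e n (Finset.univ.filter fun i => i.castSucc ≠ k) v

namespace FISharp

variable {ρ : ∀ n, Representation ℚ (Perm (Fin n)) (V n)} {φ : ∀ n, V n →ₗ[ℚ] V (n + 1)}
  (D : FISharp ρ φ) {n : ℕ}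

/-- Up to sign, the projection to the part of `V n` supported exactly on `S`. -/
def proj (n : ℕ) (S : Finset (Fin n)) : Module.End ℚ (V n) :=
  ∑ U ∈ S.powerset, (-1 : ℚ) ^ U.card • D.e n U

theorem proj_apply (S : Finset (Fin n)) (v : V n) :
    D.proj n S v = ∑ U ∈ S.powerset, (-1 : ℚ) ^ U.card • D.e n U v := by
  simp [proj]

theorem proj_e_of_subset {S T : Finset (Fin n)} (h : S ⊆ T) (v : V n) :
    D.proj n S (D.e n T v) = D.proj n S v := by
  rw [proj_apply, proj_apply]
  refine Finset.sum_congr rfl fun U hU => ?_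
  rw [D.e_e, Finset.inter_eq_left.2 ((Finset.mem_powerset.1 hU).trans h)]

/-- For i ∈ S outside T, the subsets U and U ∪ {i} of S have the same intersection with T and
opposite signs. -/
theorem proj_e_of_not_subset {S T : Finset (Fin n)} (h : ¬ S ⊆ T) (v : V n) :
    D.proj n S (D.e n T v) = 0 := by
  obtain ⟨i, hi, hiT⟩ := Finset.not_subset.1 h
  rw [proj_apply, ← Finset.insert_erase hi, Finset.sum_powerset_insert (Finset.notMem_erase i S),
    ← Finset.sum_add_distrib]
  refine Finset.sum_eq_zero fun U hU => ?_
  have hiU : i ∉ U := fun h => Finset.notMem_erase i S (Finset.mem_powerset.1 hU h)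
  rw [D.e_e, D.e_e, Finset.insert_inter_of_notMem hiT, Finset.card_insert_of_notMem hiU, pow_succ,
    mul_neg_one, neg_smul, add_neg_cancel]

theorem ρ_proj (σ : Perm (Fin n)) (S : Finset (Fin n)) (v : V n) :
    ρ n σ (D.proj n S v) = D.proj n (S.map σ.toEmbedding) (ρ n σ v) := by
  rw [proj_apply, proj_apply, map_sum]
  symm
  refine Finset.sum_bij' (fun U _ => U.map σ.symm.toEmbedding) (fun U _ => U.map σ.toEmbedding)
    ?_ ?_ ?_ ?_ ?_
  · intro U hU
    rw [Finset.mem_powerset] at *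
    intro x hx
    obtain ⟨y, hy, rfl⟩ := Finset.mem_map.1 hx
    obtain ⟨z, hz, rfl⟩ := Finset.mem_map.1 (hU hy)
    simpa using hz
  · intro U hU
    exact Finset.mem_powerset.2 (Finset.map_subset_map.2 (Finset.mem_powerset.1 hU))
  · intro U _
    ext x
    simp
  · intro U _
    ext x
    simp
  · intro U _
    rw [map_smul, D.ρ_e, Finset.card_map]
    congr 3
    ext x
    simp

theorem ρ_proj_of_fixed (σ : Perm (Fin n)) {S : Finset (Fin n)} (h : ∀ i ∈ S, σ i = i) (v : V n) :
    ρ n σ (D.proj n S v) = D.proj n S v := by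
  rw [proj_apply, map_sum]
  refine Finset.sum_congr rfl fun U hU => ?_
  rw [map_smul, D.ρ_e_of_fixed n σ U fun i hi => h i (Finset.mem_powerset.1 hU hi)]

/-- The part supported on S does not see coordinates outside S. Applied to a transposition off S
that negates a vector, this makes the S-part vanish. -/
theorem proj_ρ_of_fixed (σ : Perm (Fin n)) {S : Finset (Fin n)} (h : ∀ i ∈ S, σ i = i) (v : V n) :
    D.proj n S (ρ n σ v) = D.proj n S v := by
  rw [← D.ρ_proj_of_fixed σ h v, D.ρ_proj]
  congr 1
  have : S.map σ.toEmbedding = S := by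
    apply Finset.eq_of_subset_of_card_le _ (by rw [Finset.card_map])
    intro x hx
    obtain ⟨y, hy, rfl⟩ := Finset.mem_map.1 hx
    rw [Equiv.coe_toEmbedding, h y hy]
    exact hy
  rw [this]

/-- Möbius inversion: by induction on S all e_S v vanish, and e_univ is the identity. -/
theorem eq_zero_of_proj_eq_zero {v : V n} (h : ∀ S, D.proj n S v = 0) : v = 0 := by
  have key : ∀ S : Finset (Fin n), D.e n S v = 0 := by
    intro S
    induction S using Finset.strongInduction with
    | H S ih =>
      have h1 := h S
      rw [proj_apply, ← Finset.sum_erase_add _ _ (Finset.mem_powerset_self S),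
        Finset.sum_eq_zero, zero_add] at h1
      · exact (smul_eq_zero.1 h1).resolve_left (pow_ne_zero _ (by norm_num))
      · intro U hU
        rw [Finset.mem_erase, Finset.mem_powerset] at hU
        rw [ih U (Finset.ssubset_iff_subset_ne.2 ⟨hU.2, hU.1⟩), smul_zero]
  rw [← D.e_univ n v, key]

theorem φ_proj (S : Finset (Fin n)) (v : V n) :
    φ n (D.proj n S v) = D.proj (n + 1) (S.map Fin.castSuccEmb) (φ n v) := by
  rw [proj_apply, proj_apply, map_sum]
  refine Finset.sum_bij (fun U _ => U.map Fin.castSuccEmb) ?_ ?_ ?_ ?_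
  · intro U hU
    exact Finset.mem_powerset.2 (Finset.map_subset_map.2 (Finset.mem_powerset.1 hU))
  · intro U _ U' _ e
    exact Finset.map_injective _ e
  · intro U hU
    obtain ⟨W, hW, rfl⟩ := Finset.subset_map_iff.1 (Finset.mem_powerset.1 hU)
    exact ⟨W, Finset.mem_powerset.2 hW, rfl⟩
  · intro U _
    rw [map_smul, D.φ_e, Finset.card_map]

/-- The map `x ↦ ∑_{k ∈ R} (k, n + 1) φ(x)` is injective if `n + 1 ∈ R`. -/
theorem sum_swap_φ_injective (D : FISharp ρ φ) {R : Finset (Fin (n + 1))} (hR : Fin.last n ∈ R) :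
    Function.Injective (∑ k ∈ R, ρ (n + 1) (swap k (Fin.last n)) ∘ₗ φ n : V n →ₗ[ℚ] V (n + 1)) := by
  rw [← LinearMap.ker_eq_bot, LinearMap.ker_eq_bot']
  intro v hv
  refine D.eq_zero_of_proj_eq_zero fun S => ?_
  -- After `proj S ∘ res`, the term of k becomes `proj S v` if k ∉ S and 0 otherwise. The term k = n
  -- + 1 always survives, so a positive multiple of `proj S v` is zero.
  have h1 := congrArg (fun x => D.proj n S (D.res n x)) hv
  simp only [LinearMap.coe_sum, Finset.sum_apply, LinearMap.comp_apply, map_sum, D.res_swap_φ,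
    map_zero] at h1
  let P : Fin (n + 1) → Prop := fun k => S ⊆ Finset.univ.filter fun i => i.castSucc ≠ k
  classical
  have h2 : ∀ k ∈ R, D.proj n S (D.e n (Finset.univ.filter fun i => i.castSucc ≠ k) v) =
      if P k then D.proj n S v else 0 := by
    intro k _
    split_ifs with hk
    · exact D.proj_e_of_subset hk v
    · exact D.proj_e_of_not_subset hk v
  rw [Finset.sum_congr rfl h2, ← Finset.sum_filter, Finset.sum_const,
    ← Nat.cast_smul_eq_nsmul ℚ, smul_eq_zero] at h1
  refine h1.resolve_left ?_
  rw [Nat.cast_eq_zero, ← Ne, Finset.card_ne_zero]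
  refine ⟨Fin.last n, Finset.mem_filter.2 ⟨hR, fun i _ => ?_⟩⟩
  simp

theorem asAlgebraHom_algIncl_φ (D : FISharp ρ φ) (x : SymAlg n) (v : V n) :
    (ρ (n + 1)).asAlgebraHom (algIncl n x) (φ n v) = φ n ((ρ n).asAlgebraHom x v) := by
  induction x using MonoidAlgebra.induction_on with
  | of σ =>
    rw [MonoidAlgebra.of_apply, algIncl_single, Representation.asAlgebraHom_single_one,
      Representation.asAlgebraHom_single_one, D.consistent]
  | add x y hx hy => simp only [map_add, LinearMap.add_apply, hx, hy]
  | smul t x hx => simp only [map_smul, LinearMap.smul_apply, hx]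

theorem res_asAlgebraHom_algIncl (x : SymAlg n) (v : V (n + 1)) :
    D.res n ((ρ (n + 1)).asAlgebraHom (algIncl n x) v) = (ρ n).asAlgebraHom x (D.res n v) := by
  induction x using MonoidAlgebra.induction_on with
  | of σ =>
    rw [MonoidAlgebra.of_apply, algIncl_single, Representation.asAlgebraHom_single_one,
      Representation.asAlgebraHom_single_one, D.res_ρ]
  | add x y hx hy => simp only [map_add, LinearMap.add_apply, hx, hy]
  | smul t x hx => simp only [map_smul, LinearMap.smul_apply, hx]

end FISharp

end

section

open Equiv

/-! ### Ranges of Young symmetrizers -/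

section Ranges

variable {n : ℕ} {μ : YoungDiagram} {r c : Fin n → ℕ}
variable {W : Type*} [AddCommGroup W] [Module ℚ W]

/-- The difference of the two sides is d = (bab - Nb)a = b(aba - Na). In d x d the middle factor a x
b is a multiple of ab, and ab(aba - Na) = 0. So d x d = 0 for all x, and d = 0 by semisimplicity. -/
theorem IsPrimitiveQuasiIdempotent.swap_mul_self (hT : IsTableau μ r c) {N : ℚ}
    (hN : IsPrimitiveQuasiIdempotent (symmSum r * altSum c) N) :
    altSum c * symmSum r * (altSum c * symmSum r) = N • (altSum c * symmSum r) := by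
  rw [← sub_eq_zero]
  refine eq_zero_of_mul_mul_self_eq_zero fun x => ?_
  set a := symmSum r
  set b := altSum c
  obtain ⟨α, hα⟩ := hT.symmSum_mul_mul_altSum x
  have h1 : b * a * (b * a) - N • (b * a) = (b * a * b - N • b) * a := by
    simp only [sub_mul, smul_mul_assoc]; noncomm_ring
  have h2 : b * a * (b * a) - N • (b * a) = b * (a * b * a - N • a) := by
    simp only [mul_sub, mul_smul_comm]; noncomm_ring
  have h3 : a * b * (a * b * a - N • a) = 0 := by
    have := hN.mul_self
    rw [mul_sub, mul_smul_comm, ← mul_assoc (a * b) (a * b) a, this, smul_mul_assoc, sub_self]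
  calc (b * a * (b * a) - N • (b * a)) * x * (b * a * (b * a) - N • (b * a))
      = (b * a * b - N • b) * a * x * (b * (a * b * a - N • a)) := by
        nth_rewrite 1 [h1]
        rw [h2]
    _ = (b * a * b - N • b) * (a * x * b) * (a * b * a - N • a) := by noncomm_ring
    _ = 0 := by
      rw [hα, mul_smul_comm, smul_mul_assoc, mul_assoc, h3, mul_zero, smul_zero]

/-- The operator y maps the range of xy into that of yx, injectively, because xy acts on its own
range as the nonzero scalar N. -/
theorem finrank_range_mul_le [FiniteDimensional ℚ W] {R : Type*} [Ring R] [Algebra ℚ R]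
    (A : R →ₐ[ℚ] Module.End ℚ W) {x y : R} {N : ℚ} (hN : N ≠ 0)
    (h : x * y * (x * y) = N • (x * y)) :
    Module.finrank ℚ (LinearMap.range (A (x * y))) ≤
      Module.finrank ℚ (LinearMap.range (A (y * x))) := by
  have hmem : ∀ w ∈ LinearMap.range (A (x * y)), A y w ∈ LinearMap.range (A (y * x)) := by
    rintro _ ⟨v, rfl⟩
    exact ⟨A y v, by simp only [map_mul, Module.End.mul_apply]⟩
  refine LinearMap.finrank_le_finrank_of_injective (f := (A y).restrict hmem) ?_
  rw [← LinearMap.ker_eq_bot, LinearMap.ker_eq_bot']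
  rintro ⟨_, v, rfl⟩ hv
  have h1 : A y (A (x * y) v) = 0 := congrArg Subtype.val hv
  have h2 : A (x * y * (x * y)) v = 0 := by
    rw [map_mul, Module.End.mul_apply, map_mul A x y, Module.End.mul_apply, ← map_mul, h1, map_zero]
  rw [h, map_smul, LinearMap.smul_apply] at h2
  exact Subtype.ext ((smul_eq_zero.1 h2).resolve_left hN)

/-- Both orders are needed: `stabMap` is compatible with rows first, while `res` and the support
argument require vectors antisymmetric in the columns. -/
theorem IsTableau.finrank_range_symmSum_mul_altSum [FiniteDimensional ℚ W]
    (hT : IsTableau μ r c) (A : SymAlg n →ₐ[ℚ] Module.End ℚ W) :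
    Module.finrank ℚ (LinearMap.range (A (symmSum r * altSum c))) =
      Module.finrank ℚ (LinearMap.range (A (altSum c * symmSum r))) := by
  obtain ⟨N, hN⟩ := hT.isPrimitiveQuasiIdempotent
  exact le_antisymm (finrank_range_mul_le A hN.ne_zero hN.mul_self)
    (finrank_range_mul_le A hN.ne_zero (hN.swap_mul_self hT))

theorem finrank_range_conj {R : Type*} [Ring R] [Algebra ℚ R]
    (A : R →ₐ[ℚ] Module.End ℚ W) (x : R) {u v : R} (huv : u * v = 1) (hvu : v * u = 1) :
    Module.finrank ℚ (LinearMap.range (A (u * x * v))) =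
      Module.finrank ℚ (LinearMap.range (A x)) := by
  have h1 : ∀ w, A u (A v w) = w := fun w => by
    rw [← Module.End.mul_apply, ← map_mul, huv, map_one, Module.End.one_apply]
  have h2 : ∀ w, A v (A u w) = w := fun w => by
    rw [← Module.End.mul_apply, ← map_mul, hvu, map_one, Module.End.one_apply]
  let E : W ≃ₗ[ℚ] W := LinearEquiv.ofLinearMap (A u) (A v) (LinearMap.ext h1) (LinearMap.ext h2)
  have h3 : LinearMap.range (A (u * x * v)) = (LinearMap.range (A x)).map (E : W →ₗ[ℚ] W) := by
    ext w
    constructor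
    · rintro ⟨y, rfl⟩
      exact ⟨A x (A v y), ⟨_, rfl⟩, by simp [E]⟩
    · rintro ⟨_, ⟨y, rfl⟩, rfl⟩
      exact ⟨A u y, by simp [E, h2]⟩
  rw [h3]
  exact LinearEquiv.finrank_map_eq E _

theorem single_mul_single_inv (σ : Perm (Fin n)) :
    MonoidAlgebra.single σ (1 : ℚ) * MonoidAlgebra.single σ⁻¹ (1 : ℚ) = 1 := by
  rw [MonoidAlgebra.single_mul_single, mul_inv_cancel, one_mul]; rfl

theorem single_inv_mul_single (σ : Perm (Fin n)) :
    MonoidAlgebra.single σ⁻¹ (1 : ℚ) * MonoidAlgebra.single σ (1 : ℚ) = 1 := by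
  rw [MonoidAlgebra.single_mul_single, inv_mul_cancel, one_mul]; rfl

/-- The multiplicity of an irreducible representation is the dimension of the image of the
Young symmetrizer of any tableau. -/
theorem multiplicity_irrep [FiniteDimensional ℚ W] (ρ : Representation ℚ (Perm (Fin n)) W)
    (hμ : μ.card = n) (hT : IsTableau μ r c) :
    multiplicity (SymAlg n) (irrep μ hμ) ρ.asModule =
      Module.finrank ℚ (LinearMap.range (ρ.asAlgebraHom (symmSum r * altSum c))) := by
  have hT0 := IsTableau.of_numbering μ hμ
  obtain ⟨N, hN⟩ := hT0.isPrimitiveQuasiIdempotent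
  have : FiniteDimensional ℚ ρ.asModule := inferInstanceAs (FiniteDimensional ℚ W)
  have h1 := hN.multiplicity_eq_finrank ρ.asModule hT0.symmSum_mul_altSum_ne_zero
  obtain ⟨σ, hσ⟩ := hT.exists_conj hT0
  rw [← finrank_range_conj ρ.asAlgebraHom (symmSum r * altSum c) (single_mul_single_inv σ)
    (single_inv_mul_single σ), ← hσ]
  exact h1

end Ranges

end

section

open Equiv

/-! ### Representation stability for `FI♯`-sequences of bounded degree -/

theorem rowLen_zero_le_card (l : YoungDiagram) : l.rowLen 0 ≤ l.card := by
  rw [YoungDiagram.rowLen_eq_card]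
  exact Finset.card_le_card (Finset.filter_subset _ _)

namespace FISharp

variable {V : ℕ → Type*} [∀ n, AddCommGroup (V n)] [∀ n, Module ℚ (V n)]
variable {ρ : ∀ n, Representation ℚ (Perm (Fin n)) (V n)} {φ : ∀ n, V n →ₗ[ℚ] V (n + 1)}

/-! ### Supports of column-antisymmetric vectors -/

section Supports

variable {n : ℕ} {l : YoungDiagram} {r c : Fin n → ℕ} {h : PaddedDefined l n}

theorem ρ_altSum_mul (x : SymAlg n) {τ : Perm (Fin n)} (hτ : τ ∈ fiberPerms c) (v : V n) :
    ρ n τ ((ρ n).asAlgebraHom (altSum c * x) v) =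
      ((Perm.sign τ : ℤ) : ℚ) • (ρ n).asAlgebraHom (altSum c * x) v := by
  rw [← Representation.asAlgebraHom_single_one, ← Module.End.mul_apply, ← map_mul, ← mul_assoc,
    single_mul_altSum hτ, smul_mul_assoc, map_smul, LinearMap.smul_apply]

/-- The support of a column-antisymmetric vector misses at most one box of each column. -/
theorem injOn_compl_of_proj_ne_zero (D : FISharp ρ φ) (x : SymAlg n) (v : V n) {S : Finset (Fin n)}
    (hS : D.proj n S ((ρ n).asAlgebraHom (altSum c * x) v) ≠ 0) :
    Set.InjOn c (Sᶜ : Finset (Fin n)) := by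
  intro i hi j hj hij
  by_contra hne
  apply hS
  have hi' : i ∉ S := by simpa using hi
  have hj' : j ∉ S := by simpa using hj
  -- A transposition within a column negates the vector, but off S it cannot change the S-part.
  have h1 := D.proj_ρ_of_fixed (swap i j) (S := S) (fun k hk => swap_apply_of_ne_of_ne
    (fun e => hi' (e ▸ hk)) (fun e => hj' (e ▸ hk))) ((ρ n).asAlgebraHom (altSum c * x) v)
  rw [ρ_altSum_mul x (swap_mem_fiberPerms hij), map_smul, Perm.sign_swap hne] at h1
  simp only [Units.val_neg, Units.val_one, Int.cast_neg, Int.cast_one, neg_smul, one_smul] at h1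
  have h2 : (2 : ℚ) • D.proj n S ((ρ n).asAlgebraHom (altSum c * x) v) = 0 := by
    rw [two_smul]
    nth_rewrite 1 [← h1]
    exact neg_add_cancel _
  exact (smul_eq_zero.1 h2).resolve_left two_ne_zero

/-- The complement of S injects into the n - |λ| columns. -/
theorem card_compl_add_le (D : FISharp ρ φ) (hT : IsTableau (padded l n h) r c) (x : SymAlg n)
    (v : V n) {S : Finset (Fin n)}
    (hS : D.proj n S ((ρ n).asAlgebraHom (altSum c * x) v) ≠ 0) : l.card ≤ S.card := by
  have h1 := Finset.card_le_card_of_injOn (t := Finset.range (n - l.card)) c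
    (fun i _ => by simpa using hT.col_lt i) (D.injOn_compl_of_proj_ne_zero x v hS)
  rw [Finset.card_compl, Fintype.card_fin, Finset.card_range] at h1
  have h2 := h
  unfold PaddedDefined at h2
  have h3 : S.card ≤ n := by simpa using Finset.card_le_univ S
  omega

/-- `V(λ)_n` does not occur in `V n` if `|λ|` exceeds the degree. -/
theorem range_altSum_mul_eq_bot (D : FISharp ρ φ) {q : ℕ}
    (hdeg : ∀ (S : Finset (Fin n)) (v : V n), q < S.card → D.proj n S v = 0) (hq : q < l.card)
    (hT : IsTableau (padded l n h) r c) (x : SymAlg n) :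
    LinearMap.range ((ρ n).asAlgebraHom (altSum c * x)) = ⊥ := by
  rw [eq_bot_iff]
  rintro _ ⟨v, rfl⟩
  refine D.eq_zero_of_proj_eq_zero fun S => ?_
  by_contra hS
  exact hS (hdeg S _ (hq.trans_le (D.card_compl_add_le hT x v hS)))

/-- The source of the range 2q: if the complement of S lay in the first λ₁ columns, then n - |S| ≤
λ₁ ≤ |λ| ≤ |S| ≤ q, so n ≤ 2q. Columns from index λ₁ on have a single box. -/
theorem exists_singleton_column (D : FISharp ρ φ) {q : ℕ}
    (hdeg : ∀ (S : Finset (Fin n)) (v : V n), q < S.card → D.proj n S v = 0) (hn : 2 * q < n)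
    (hT : IsTableau (padded l n h) r c) (x : SymAlg n) (v : V n) {S : Finset (Fin n)}
    (hS : D.proj n S ((ρ n).asAlgebraHom (altSum c * x) v) ≠ 0) :
    ∃ j, j ∉ S ∧ l.rowLen 0 ≤ c j := by
  by_contra! hcon
  have h1 := Finset.card_le_card_of_injOn (t := Finset.range (l.rowLen 0)) c
    (fun i hi => by simpa using hcon i (by simpa using hi)) (D.injOn_compl_of_proj_ne_zero x v hS)
  rw [Finset.card_compl, Fintype.card_fin, Finset.card_range] at h1
  have h2 := D.card_compl_add_le hT x v hS
  have h3 : S.card ≤ q := not_lt.1 fun h => hS (hdeg S _ h)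
  have h4 := rowLen_zero_le_card l
  omega

end Supports

/-! ### Comparing the multiplicities for n and n + 1 -/

section Comparison

variable {n : ℕ} {l : YoungDiagram} {r c : Fin n → ℕ} {h : PaddedDefined l n}

local notation "r⁺" => (Fin.snoc r 0 : Fin (n + 1) → ℕ)
local notation "c⁺" => (Fin.snoc c (n - YoungDiagram.card l) : Fin (n + 1) → ℕ)

/-- The map `c_T V_n → c_{T⁺} V_{n+1}`. -/
def stabMap (ρ : ∀ n, Representation ℚ (Perm (Fin n)) (V n)) (φ : ∀ n, V n →ₗ[ℚ] V (n + 1))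
    (r : Fin n → ℕ) : V n →ₗ[ℚ] V (n + 1) :=
  ∑ k ∈ Finset.univ.filter (fun k => (Fin.snoc r 0 : Fin (n + 1) → ℕ) k = 0),
    ρ (n + 1) (swap k (Fin.last n)) ∘ₗ φ n

theorem stabMap_injective (D : FISharp ρ φ) (r : Fin n → ℕ) :
    Function.Injective (stabMap ρ φ r) :=
  D.sum_swap_φ_injective (by simp)

/-- The coset decomposition of the new row sum, followed by equivariance of φ for the old tableau
sums. -/
theorem stabMap_apply_youngSymmetrizer (D : FISharp ρ φ) (hT : IsTableau (padded l n h) r c)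
    (v : V n) : stabMap ρ φ r ((ρ n).asAlgebraHom (symmSum r * altSum c) v) =
      (ρ (n + 1)).asAlgebraHom (symmSum r⁺ * altSum c⁺) (φ n v) := by
  rw [symmSum_snoc, ← algIncl_altSum (fun i => (hT.col_lt i).ne), mul_assoc,
    ← map_mul (algIncl n), map_mul (ρ (n + 1)).asAlgebraHom, Module.End.mul_apply,
    D.asAlgebraHom_algIncl_φ, stabMap, map_sum, LinearMap.sum_apply,
    LinearMap.sum_apply]
  simp only [Representation.asAlgebraHom_single_one, LinearMap.comp_apply]

theorem finrank_le_finrank_succ (D : FISharp ρ φ) [FiniteDimensional ℚ (V (n + 1))]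
    (hT : IsTableau (padded l n h) r c) :
    Module.finrank ℚ (LinearMap.range ((ρ n).asAlgebraHom (symmSum r * altSum c))) ≤
      Module.finrank ℚ (LinearMap.range ((ρ (n + 1)).asAlgebraHom (symmSum r⁺ * altSum c⁺))) := by
  have hmem : ∀ w ∈ LinearMap.range ((ρ n).asAlgebraHom (symmSum r * altSum c)),
      stabMap ρ φ r w ∈
        LinearMap.range ((ρ (n + 1)).asAlgebraHom (symmSum r⁺ * altSum c⁺)) := by
    rintro _ ⟨v, rfl⟩
    exact ⟨φ n v, (D.stabMap_apply_youngSymmetrizer hT v).symm⟩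
  refine LinearMap.finrank_le_finrank_of_injective (f := (stabMap ρ φ r).restrict hmem) ?_
  intro x y hxy
  exact Subtype.ext (D.stabMap_injective r (congrArg Subtype.val hxy))

/-- The new row sum is a multiple of `symmSum r` times itself and the new column sum is the old one,
so the old product can be pulled out through the equivariance of `res`. -/
theorem res_mem_range (D : FISharp ρ φ) (hT : IsTableau (padded l n h) r c) (v : V (n + 1)) :
    D.res n ((ρ (n + 1)).asAlgebraHom (altSum c⁺ * symmSum r⁺) v) ∈
      LinearMap.range ((ρ n).asAlgebraHom (altSum c * symmSum r)) := by
  have h1 : symmSum r⁺ = ((fiberPerms r).card : ℚ)⁻¹ • (algIncl n (symmSum r) * symmSum r⁺) := by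
    rw [algIncl_symmSum_mul_symmSum_snoc, smul_smul, inv_mul_cancel₀, one_smul]
    rw [Nat.cast_ne_zero, Finset.card_ne_zero]
    exact ⟨1, one_mem_fiberPerms r⟩
  refine ⟨((fiberPerms r).card : ℚ)⁻¹ •
    D.res n ((ρ (n + 1)).asAlgebraHom (symmSum r⁺) v), ?_⟩
  conv_rhs => rw [h1]
  rw [mul_smul_comm, map_smul, map_smul, LinearMap.smul_apply, map_smul,
    ← algIncl_altSum (fun i => (hT.col_lt i).ne), ← mul_assoc, ← map_mul (algIncl n),
    map_mul (ρ (n + 1)).asAlgebraHom, Module.End.mul_apply, D.res_asAlgebraHom_algIncl]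

/-- Points alone in their columns are fixed by every column permutation. -/
theorem commute_swap_altSum {m : ℕ} {hm : PaddedDefined l m} {r c : Fin m → ℕ}
    (hT : IsTableau (padded l m hm) r c) {i j : Fin m}
    (hi : l.rowLen 0 ≤ c i) (hj : l.rowLen 0 ≤ c j) :
    MonoidAlgebra.single (swap i j) (1 : ℚ) * altSum c =
      altSum c * MonoidAlgebra.single (swap i j) (1 : ℚ) := by
  rw [altSum, Finset.mul_sum, Finset.sum_mul]
  refine Finset.sum_congr rfl fun τ hτ => ?_
  have hfix : ∀ k, l.rowLen 0 ≤ c k → τ k = k := by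
    intro k hk
    have h1 := mem_fiberPerms.1 hτ k
    exact hT.injective _ _ (by
      rw [hT.row_eq_zero_iff hk, hT.row_eq_zero_iff (h1.symm ▸ hk : l.rowLen 0 ≤ c (τ k))]) h1
  rw [MonoidAlgebra.single_mul_single, MonoidAlgebra.single_mul_single, mul_comm (1 : ℚ),
    mul_swap_eq_swap_mul, hfix i hi, hfix j hj]

/-- If `res` kills x, all parts of x supported away from n + 1 vanish. If the S-part is nonzero,
then n + 1 ∈ S, and some j ∉ S is alone in its column. The transposition of j and n + 1 fixes x: it
commutes with the column sum and is absorbed by the row sum. It carries S to a set avoiding n + 1, a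
contradiction. -/
theorem res_injective_on_range (D : FISharp ρ φ) {q : ℕ}
    (hdeg : ∀ (S : Finset (Fin (n + 1))) (v : V (n + 1)), q < S.card → D.proj (n + 1) S v = 0)
    (hn : 2 * q ≤ n) (hT : IsTableau (padded l n h) r c) (v : V (n + 1))
    (hv : D.res n ((ρ (n + 1)).asAlgebraHom (altSum c⁺ * symmSum r⁺) v) = 0) :
    (ρ (n + 1)).asAlgebraHom (altSum c⁺ * symmSum r⁺) v = 0 := by
  have hT' := hT.snoc
  refine D.eq_zero_of_proj_eq_zero fun S => ?_
  have hlast : ∀ U : Finset (Fin (n + 1)), Fin.last n ∉ U →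
      D.proj (n + 1) U ((ρ (n + 1)).asAlgebraHom (altSum c⁺ * symmSum r⁺) v) = 0 := by
    intro U hU
    rw [← D.proj_e_of_subset (T := Finset.univ.erase (Fin.last n))
      (fun i hi => Finset.mem_erase.2 ⟨fun e => hU (e ▸ hi), Finset.mem_univ _⟩), ← D.φ_res, hv,
      map_zero, map_zero]
  by_contra hS
  -- The support bound is applied to n + 1 points, so 2q ≤ n is enough.
  obtain ⟨j, hjS, hj⟩ := D.exists_singleton_column hdeg (Nat.lt_succ_of_le hn) hT' _ v hS
  have hl : Fin.last n ∈ S := by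
    by_contra hl
    exact hS (hlast S hl)
  have hlc : l.rowLen 0 ≤ c⁺ (Fin.last n) := by
    have := h
    unfold PaddedDefined at this
    rw [Fin.snoc_last]
    omega
  have hfix : ρ (n + 1) (swap j (Fin.last n))
      ((ρ (n + 1)).asAlgebraHom (altSum c⁺ * symmSum r⁺) v) =
        (ρ (n + 1)).asAlgebraHom (altSum c⁺ * symmSum r⁺) v := by
    rw [← Representation.asAlgebraHom_single_one, ← Module.End.mul_apply, ← map_mul, ← mul_assoc,
      commute_swap_altSum hT' hj hlc, mul_assoc, single_mul_symmSum]
    exact swap_mem_fiberPerms (by rw [hT'.row_eq_zero_iff hj, hT'.row_eq_zero_iff hlc])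
  apply hS
  have h1 := D.ρ_proj (swap j (Fin.last n)) S
    ((ρ (n + 1)).asAlgebraHom (altSum c⁺ * symmSum r⁺) v)
  rw [hfix, hlast (S.map _)] at h1
  · have h2 := congrArg (ρ (n + 1) (swap j (Fin.last n))) h1
    rwa [map_zero, ← Module.End.mul_apply, ← map_mul, swap_mul_self, map_one,
      Module.End.one_apply] at h2
  · intro hmem
    obtain ⟨k, hk, e⟩ := Finset.mem_map.1 hmem
    have : k = j := by
      rw [Equiv.coe_toEmbedding] at e
      apply (swap j (Fin.last n)).injective
      rw [e, swap_apply_left]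
    exact hjS (this ▸ hk)

theorem finrank_succ_le_finrank (D : FISharp ρ φ) [FiniteDimensional ℚ (V n)] {q : ℕ}
    (hdeg : ∀ (S : Finset (Fin (n + 1))) (v : V (n + 1)), q < S.card → D.proj (n + 1) S v = 0)
    (hn : 2 * q ≤ n) (hT : IsTableau (padded l n h) r c) :
    Module.finrank ℚ (LinearMap.range ((ρ (n + 1)).asAlgebraHom (altSum c⁺ * symmSum r⁺))) ≤
      Module.finrank ℚ (LinearMap.range ((ρ n).asAlgebraHom (altSum c * symmSum r))) := by
  have hmem : ∀ w ∈ LinearMap.range ((ρ (n + 1)).asAlgebraHom (altSum c⁺ * symmSum r⁺)),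
      D.res n w ∈ LinearMap.range ((ρ n).asAlgebraHom (altSum c * symmSum r)) := by
    rintro _ ⟨v, rfl⟩
    exact D.res_mem_range hT v
  refine LinearMap.finrank_le_finrank_of_injective (f := (D.res n).restrict hmem) ?_
  rw [← LinearMap.ker_eq_bot, LinearMap.ker_eq_bot']
  rintro ⟨_, v, rfl⟩ hv
  exact Subtype.ext (D.res_injective_on_range hdeg hn hT v (congrArg Subtype.val hv))

end Comparison

/-! ### Monotonicity and uniform stability from the degree bound -/

section Stability

variable (D : FISharp ρ φ) {q : ℕ}

theorem mult_succ [∀ n, FiniteDimensional ℚ (V n)]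
    (hdeg : ∀ n (S : Finset (Fin n)) (v : V n), q < S.card → D.proj n S v = 0) {n : ℕ}
    (hn : 2 * q ≤ n) (l : YoungDiagram) (h : PaddedDefined l n) :
    mult ρ l (n + 1) = mult ρ l n := by
  have hT := IsTableau.of_numbering (padded l n h) (card_padded l n h)
  rw [mult, mult, dif_pos h, dif_pos h.succ, multiplicity_irrep _ _ hT,
    multiplicity_irrep _ _ hT.snoc]
  refine le_antisymm ?_ (D.finrank_le_finrank_succ hT)
  rw [hT.finrank_range_symmSum_mul_altSum, hT.snoc.finrank_range_symmSum_mul_altSum]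
  exact D.finrank_succ_le_finrank (hdeg (n + 1)) hn hT

theorem mult_eq_zero [∀ n, FiniteDimensional ℚ (V n)]
    (hdeg : ∀ n (S : Finset (Fin n)) (v : V n), q < S.card → D.proj n S v = 0)
    (l : YoungDiagram) (hq : q < l.card) (n : ℕ) : mult ρ l n = 0 := by
  rw [mult]
  split_ifs with h
  · have hT := IsTableau.of_numbering (padded l n h) (card_padded l n h)
    rw [multiplicity_irrep _ _ hT, hT.finrank_range_symmSum_mul_altSum,
      D.range_altSum_mul_eq_bot (hdeg n) hq hT, finrank_bot]
  · rfl

/-- For |λ| > q the multiplicity is always 0. Otherwise |λ| + λ₁ ≤ 2q, so the padded partition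
exists throughout the range and the default value of `mult` never interferes. -/
theorem multiplicityStable [∀ n, FiniteDimensional ℚ (V n)]
    (hdeg : ∀ n (S : Finset (Fin n)) (v : V n), q < S.card → D.proj n S v = 0)
    (l : YoungDiagram) : ∃ k : ℕ, ∀ n, 2 * q ≤ n → mult ρ l n = k := by
  rcases lt_or_ge q l.card with hq | hq
  · exact ⟨0, fun n _ => D.mult_eq_zero hdeg l hq n⟩
  · refine ⟨mult ρ l (2 * q), fun n hn => ?_⟩
    induction n, hn using Nat.le_induction with
    | base => rfl
    | succ n hn ih =>
      rw [← ih]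
      refine D.mult_succ hdeg hn l ?_
      have := rowLen_zero_le_card l
      unfold PaddedDefined
      omega

/-- Since n + 1 > q, `proj univ` vanishes, which writes x as a combination of e_U x with U proper.
Each of these misses a coordinate and is a translate of an element in the image of φ. -/
theorem spanImage_top
    (hdeg : ∀ n (S : Finset (Fin n)) (v : V n), q < S.card → D.proj n S v = 0) {n : ℕ}
    (hn : q ≤ n) : spanImage ρ φ n ⊤ = ⊤ := by
  rw [eq_top_iff]
  intro x _
  let P := spanImage ρ φ n ⊤
  let E := (ρ (n + 1)).asModuleEquiv
  have hρ : ∀ (σ : Perm (Fin (n + 1))) (v : V (n + 1)), E.symm v ∈ P → E.symm (ρ (n + 1) σ v) ∈ P := by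
    intro σ v hv
    rw [Representation.asModuleEquiv_symm_map_rho]
    exact P.smul_mem _ hv
  have hφ : ∀ v : V n, E.symm (φ n v) ∈ P := fun v =>
    Submodule.subset_span ⟨(ρ n).asModuleEquiv.symm v, trivial, by simp [E]⟩
  have he : ∀ U : Finset (Fin (n + 1)), U ≠ Finset.univ →
      ∀ v : V (n + 1), E.symm (D.e (n + 1) U v) ∈ P := by
    intro U hU v
    obtain ⟨i, hi⟩ : ∃ i, i ∉ U := by
      by_contra! hcon
      exact hU (Finset.eq_univ_of_forall hcon)
    set t := swap i (Fin.last n)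
    -- After moving a missing coordinate i to the last place, φ ∘ res acts as the identity.
    have h1 : D.e (n + 1) U v = ρ (n + 1) t (φ n (D.res n (ρ (n + 1) t (D.e (n + 1) U v)))) := by
      rw [D.φ_res, D.ρ_e, ← Module.End.mul_apply (ρ (n + 1) t), ← map_mul, swap_mul_self, map_one,
        Module.End.one_apply, D.e_e]
      congr 2
      symm
      rw [Finset.inter_eq_right]
      intro k hk
      refine Finset.mem_map.2 ⟨t k, Finset.mem_erase.2 ⟨fun e => ?_, Finset.mem_univ _⟩, ?_⟩
      · have : k = i := by
          apply t.injective
          rw [e, swap_apply_left]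
        exact hi (this ▸ hk)
      · rw [Equiv.coe_toEmbedding, ← Perm.mul_apply, swap_mul_self, Perm.one_apply]
    rw [h1]
    exact hρ _ _ (hφ _)
  have h0 := hdeg (n + 1) Finset.univ (E x) (by simpa using Nat.lt_succ_of_le hn)
  rw [proj_apply, ← Finset.sum_erase_add _ _ (Finset.mem_powerset_self Finset.univ),
    D.e_univ] at h0
  set m := (Finset.univ : Finset (Fin (n + 1))).card
  have h1 : (-1 : ℚ) ^ m • x = -∑ U ∈ Finset.univ.powerset.erase Finset.univ,
      (-1 : ℚ) ^ U.card • E.symm (D.e (n + 1) U (E x)) := by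
    apply E.injective
    rw [map_smul, map_neg, map_sum, eq_neg_iff_add_eq_zero]
    refine (add_comm _ _).trans (Eq.trans (congrArg (· + _) (Finset.sum_congr rfl fun U _ => ?_)) h0)
    rw [map_smul, LinearEquiv.apply_symm_apply]
  have h2 : (-1 : ℚ) ^ m • x ∈ P := by
    rw [h1]
    exact P.neg_mem (P.sum_mem fun U hU =>
      P.smul_of_tower_mem _ (he U (Finset.ne_of_mem_erase hU) _))
  have h3 := P.smul_of_tower_mem ((-1 : ℚ) ^ m) h2
  rwa [smul_smul, ← mul_pow, neg_one_mul, neg_neg, one_pow, one_smul] at h3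

theorem stabMap_mem_spanImage {n : ℕ} (r : Fin n → ℕ)
    (W : Submodule (SymAlg n) (ρ n).asModule) {w : (ρ n).asModule} (hw : w ∈ W) :
    (ρ (n + 1)).asModuleEquiv.symm (stabMap ρ φ r ((ρ n).asModuleEquiv w)) ∈
      spanImage ρ φ n W := by
  rw [stabMap, LinearMap.sum_apply, map_sum]
  refine Submodule.sum_mem _ fun k _ => ?_
  rw [LinearMap.comp_apply, Representation.asModuleEquiv_symm_map_rho]
  exact Submodule.smul_mem _ _ (Submodule.subset_span ⟨w, hw, by simp⟩)

/-- The generators of the k summands of W are independent vectors fixed, up to N, by the Young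
symmetrizer. Their images under `stabMap` stay independent and lie in the range of the extended
symmetrizer; they generate the required copy. The permutation σ passes from the extended tableau to
the numbering used by `paddedIrrep`. -/
theorem span_contains (D : FISharp ρ φ) {n : ℕ} (l : YoungDiagram) (h : PaddedDefined l n) (k : ℕ)
    (W : Submodule (SymAlg n) (ρ n).asModule)
    (hW : Nonempty (W ≃ₗ[SymAlg n] (Fin k → paddedIrrep l n h))) :
    ∃ U : Submodule (SymAlg (n + 1)) (ρ (n + 1)).asModule, U ≤ spanImage ρ φ n W ∧
      Nonempty (U ≃ₗ[SymAlg (n + 1)] (Fin k → paddedIrrep l (n + 1) h.succ)) := by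
  obtain ⟨F⟩ := hW
  have hT := IsTableau.of_numbering (padded l n h) (card_padded l n h)
  have hT' := IsTableau.of_numbering (padded l (n + 1) h.succ) (card_padded l (n + 1) h.succ)
  obtain ⟨N, hN⟩ := hT.isPrimitiveQuasiIdempotent
  obtain ⟨N', hN'⟩ := hT'.isPrimitiveQuasiIdempotent
  obtain ⟨σ, hσ⟩ := hT.snoc.exists_conj hT'
  obtain ⟨v, hv, hcv, hvW⟩ := hN.linearIndependent_of_injective hT.symmSum_mul_altSum_ne_zero
    (W.subtype ∘ₗ F.symm.toLinearMap) (Subtype.val_injective.comp F.symm.injective)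
  have hvW' : ∀ i, v i ∈ W := fun i => by
    obtain ⟨x, hx⟩ := hvW i
    rw [← hx]
    exact (F.symm x).2
  set r := rowOf (padded l n h) (card_padded l n h)
  set c := colOf (padded l n h) (card_padded l n h)
  set r' := rowOf (padded l (n + 1) h.succ) (card_padded l (n + 1) h.succ)
  set c' := colOf (padded l (n + 1) h.succ) (card_padded l (n + 1) h.succ)
  let L : (ρ n).asModule →ₗ[ℚ] (ρ (n + 1)).asModule :=
    (ρ (n + 1)).asModuleEquiv.symm.toLinearMap ∘ₗ ρ (n + 1) σ ∘ₗ stabMap ρ φ r ∘ₗ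
      (ρ n).asModuleEquiv.toLinearMap
  have hLσ : ∀ x, L x = MonoidAlgebra.single σ (1 : ℚ) •
      (ρ (n + 1)).asModuleEquiv.symm (stabMap ρ φ r ((ρ n).asModuleEquiv x)) := fun x =>
    Representation.asModuleEquiv_symm_map_rho _ _ _
  have hL : LinearMap.ker L = ⊥ := by
    rw [LinearMap.ker_eq_bot]
    have hinj : Function.Injective (ρ (n + 1) σ) :=
      Function.LeftInverse.injective (g := ρ (n + 1) σ⁻¹) fun x => by
        change (ρ (n + 1) σ⁻¹ * ρ (n + 1) σ) x = x
        rw [← map_mul, inv_mul_cancel, map_one, Module.End.one_apply]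
    exact (ρ (n + 1)).asModuleEquiv.symm.injective.comp
      (hinj.comp ((D.stabMap_injective r).comp (ρ n).asModuleEquiv.injective))
  have hLc : ∀ x, L ((symmSum r * altSum c) • x) = (symmSum r' * altSum c') •
      (MonoidAlgebra.single σ (1 : ℚ) •
        (ρ (n + 1)).asModuleEquiv.symm (φ n ((ρ n).asModuleEquiv x))) := by
    intro x
    rw [hLσ, Representation.asModuleEquiv_map_smul, D.stabMap_apply_youngSymmetrizer hT, hσ,
      ← mul_smul, mul_assoc, single_inv_mul_single, mul_one, mul_smul]
    congr 1
  have hcL : ∀ i, (symmSum r' * altSum c') • L (v i) = N' • L (v i) := by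
    intro i
    have h1 : v i = N⁻¹ • (symmSum r * altSum c) • v i := by
      rw [hcv, smul_smul, inv_mul_cancel₀ hN.ne_zero, one_smul]
    rw [h1, map_smul, hLc, smul_algebra_smul_comm, hN'.smul_smul_eq, smul_comm]
  obtain ⟨g, hg, hgr⟩ := hN'.exists_injective_of_linearIndependent (fun i => L (v i))
    (hv.map' L hL) hcL
  refine ⟨LinearMap.range g, hgr.trans (Submodule.span_le.2 ?_),
    ⟨(LinearEquiv.ofInjective g hg).symm⟩⟩
  rintro _ ⟨i, rfl⟩
  change L (v i) ∈ spanImage ρ φ n W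
  rw [hLσ]
  exact Submodule.smul_mem _ _ (stabMap_mem_spanImage r W (hvW' i))

theorem injective (D : FISharp ρ φ) (n : ℕ) : Function.Injective (φ n) :=
  Function.LeftInverse.injective (D.res_φ n)

theorem monotoneSeq (D : FISharp ρ φ) (N : ℕ) : MonotoneSeq ρ φ N where
  consistent := D.consistent
  injective := D.injective
  span_contains _ _ l h k W hW := D.span_contains l h k W hW

theorem uniformlyRepStable (D : FISharp ρ φ) [∀ n, FiniteDimensional ℚ (V n)]
    (hdeg : ∀ n (S : Finset (Fin n)) (v : V n), q < S.card → D.proj n S v = 0) :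
    UniformlyRepStable ρ φ (2 * q) where
  finiteDimensional := inferInstance
  consistent n _ := D.consistent n
  injective n _ := D.injective n
  surjective n hn := D.spanImage_top hdeg (by omega)
  multiplicityStable := D.multiplicityStable hdeg

end Stability

end FISharp

end

section

open Equiv

/-! ### Polynomial growth bounds the degree -/

theorem exists_lt_choose (k q C m : ℕ) (hq : q < k) :
    ∃ n, m ≤ n ∧ C * (n + 1) ^ q < n.choose k := by
  -- With n = N + k - 1 one has choose(n, k) ≥ N^k / k! and n + 1 = N + k ≤ (k + 1)N. Failure of the
  -- bound would give N^{q+1} ≤ K N^q, impossible for N > K.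
  set K := k.factorial * (C * (k + 1) ^ q)
  set N := K + m + 1
  refine ⟨N + k - 1, by omega, ?_⟩
  by_contra! hle
  have h1 : (N + k - 1 + 1 - k) ^ k ≤ k.factorial * (N + k - 1).choose k := by
    have h0 := Nat.pow_le_choose (α := ℚ) k (N + k - 1)
    rw [div_le_iff₀' (by positivity)] at h0
    exact_mod_cast h0
  have h2 : N + k - 1 + 1 = N + k := by omega
  rw [h2, Nat.add_sub_cancel] at h1
  rw [h2] at hle
  have h3 : N + k ≤ (k + 1) * N := by
    have : 1 ≤ N := by omega
    nlinarith
  have h4 : N ^ k ≤ K * N ^ q := calc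
    N ^ k ≤ k.factorial * (C * (N + k) ^ q) := h1.trans (Nat.mul_le_mul_left _ hle)
    _ ≤ k.factorial * (C * ((k + 1) * N) ^ q) := by gcongr
    _ = K * N ^ q := by rw [mul_pow]; ring
  have h5 : N * N ^ q ≤ N ^ k := by
    rw [← pow_succ']
    exact Nat.pow_le_pow_right (by omega) hq
  have h6 : 0 < N ^ q := by positivity
  have h7 := Nat.le_of_mul_le_mul_right (h5.trans h4) h6
  omega

namespace FISharp

variable {V : ℕ → Type*} [∀ n, AddCommGroup (V n)] [∀ n, Module ℚ (V n)]
variable {ρ : ∀ n, Representation ℚ (Perm (Fin n)) (V n)} {φ : ∀ n, V n →ₗ[ℚ] V (n + 1)}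

theorem proj_proj_self (D : FISharp ρ φ) {n : ℕ} (S : Finset (Fin n)) (v : V n) :
    D.proj n S (D.proj n S v) = (-1 : ℚ) ^ S.card • D.proj n S v := by
  rw [proj_apply D S v, map_sum, Finset.sum_eq_single S]
  · rw [map_smul, D.proj_e_of_subset subset_rfl, proj_apply D S v]
  · intro U hU hne
    rw [map_smul, D.proj_e_of_not_subset, smul_zero]
    exact fun h => hne (subset_antisymm (Finset.mem_powerset.1 hU) h)
  · exact fun h => absurd (Finset.mem_powerset_self S) h

theorem proj_proj_of_ne (D : FISharp ρ φ) {n : ℕ} {S T : Finset (Fin n)} (h : S.card = T.card)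
    (hne : S ≠ T) (v : V n) : D.proj n S (D.proj n T v) = 0 := by
  rw [proj_apply D T v, map_sum]
  refine Finset.sum_eq_zero fun U hU => ?_
  rw [map_smul, D.proj_e_of_not_subset, smul_zero]
  exact fun hS => hne (Finset.eq_of_subset_of_card_le (hS.trans (Finset.mem_powerset.1 hU)) h.ge)

theorem exists_proj_ne_zero_of_card_eq (D : FISharp ρ φ) {n : ℕ} {S T : Finset (Fin n)}
    (h : S.card = T.card) {v : V n} (hv : D.proj n S v ≠ 0) : ∃ w, D.proj n T w ≠ 0 := by
  let σ : Perm (Fin n) := Equiv.extendSubtype (Finset.equivOfCardEq h)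
  have hσ : S.map σ.toEmbedding = T := by
    apply Finset.eq_of_subset_of_card_le
    · intro x hx
      obtain ⟨y, hy, rfl⟩ := Finset.mem_map.1 hx
      exact Equiv.extendSubtype_mem (Finset.equivOfCardEq h) y hy
    · rw [Finset.card_map, h]
  refine ⟨ρ n σ v, fun h0 => hv ?_⟩
  rw [← hσ, ← D.ρ_proj] at h0
  have h1 := congrArg (ρ n σ⁻¹) h0
  rwa [map_zero, ← Module.End.mul_apply, ← map_mul, inv_mul_cancel, map_one,
    Module.End.one_apply] at h1

/-- Up to sign the `proj T` with |T| = |S| are mutually orthogonal idempotents, all nonzero by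
symmetry, so one vector from each range gives an independent family. -/
theorem choose_le_finrank (D : FISharp ρ φ) {n : ℕ} [FiniteDimensional ℚ (V n)]
    {S : Finset (Fin n)} {v : V n} (hv : D.proj n S v ≠ 0) :
    n.choose S.card ≤ Module.finrank ℚ (V n) := by
  let I := {T : Finset (Fin n) // T ∈ Finset.powersetCard S.card Finset.univ}
  have hI : ∀ T : I, S.card = T.1.card := fun T => (Finset.mem_powersetCard.1 T.2).2.symm
  choose w hw using fun T : I => D.exists_proj_ne_zero_of_card_eq (hI T) hv
  have hli : LinearIndependent ℚ fun T : I => D.proj n T.1 (w T) := by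
    rw [Fintype.linearIndependent_iff]
    intro t ht T
    have h1 := congrArg (D.proj n T.1) ht
    rw [map_sum, Finset.sum_eq_single T, map_smul, D.proj_proj_self, map_zero, smul_eq_zero,
      smul_eq_zero] at h1
    · rcases h1 with h1 | h1 | h1
      · exact h1
      · exact absurd h1 (pow_ne_zero _ (by norm_num))
      · exact absurd h1 (hw T)
    · intro U _ hU
      rw [map_smul, D.proj_proj_of_ne ((hI T).symm.trans (hI U)) fun e => hU (Subtype.ext e.symm),
        smul_zero]
    · exact fun h => absurd (Finset.mem_univ T) h
  have h2 := hli.fintype_card_le_finrank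
  rwa [Fintype.card_coe, Finset.card_powersetCard, Finset.card_univ, Fintype.card_fin] at h2

/-- A nonzero S-part survives under the injective φ for all m ≥ n, so the dimensions would grow at
least like choose(m, |S|), faster than m^q. -/
theorem proj_eq_zero_of_growth (D : FISharp ρ φ) [∀ n, FiniteDimensional ℚ (V n)] {q C : ℕ}
    (hC : ∀ n, Module.finrank ℚ (V n) ≤ C * (n + 1) ^ q) (n : ℕ) (S : Finset (Fin n)) (v : V n)
    (hS : q < S.card) : D.proj n S v = 0 := by
  by_contra hv
  obtain ⟨m, hm, hlt⟩ := exists_lt_choose S.card q C n hS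
  have key : ∃ (T : Finset (Fin m)) (w : V m), T.card = S.card ∧ D.proj m T w ≠ 0 := by
    clear hlt
    induction m, hm using Nat.le_induction with
    | base => exact ⟨S, v, rfl, hv⟩
    | succ m _ ih =>
      obtain ⟨T, w, hT, hw⟩ := ih
      refine ⟨T.map Fin.castSuccEmb, φ m w, by rw [Finset.card_map, hT], ?_⟩
      rw [← D.φ_proj]
      exact fun h => hw (D.injective m (h.trans (map_zero _).symm))
  obtain ⟨T, w, hT, hw⟩ := key
  have := D.choose_le_finrank hw
  rw [hT] at this
  exact absurd (hC m) (not_le.2 (hlt.trans_le this))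

end FISharp

/-! ### The `FI♯`-structure on the cohomology of the powers of a group -/

section Power

variable (G : Type) [Group G]

/-- The endomorphism of `G^n` replacing the coordinates outside `S` by `1`. -/
def maskHom {n : ℕ} (S : Finset (Fin n)) : (Fin n → G) →* (Fin n → G) where
  toFun g i := if i ∈ S then g i else 1
  map_one' := by ext; simp
  map_mul' g h := by
    ext i
    by_cases hi : i ∈ S <;> simp [hi]

/-- The homomorphism `G^n → G^{n+1}` inserting `1` as the last coordinate. -/
def snocOneHom (n : ℕ) : (Fin n → G) →* (Fin (n + 1) → G) where
  toFun g := Fin.snoc g 1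
  map_one' := by
    ext i
    induction i using Fin.lastCases <;> simp
  map_mul' g h := by
    ext i
    induction i using Fin.lastCases <;> simp

variable {G}

theorem pullback_pullback {H K L : Type} [Group H] [Group K] [Group L] (f : K →* L) (g : H →* K)
    (q : ℕ) (x : rationalCohomology L q) :
    pullback g q (pullback f q x) = pullback (f.comp g) q x := by
  rw [pullback_comp]; rfl

theorem maskHom_apply {n : ℕ} (S : Finset (Fin n)) (g : Fin n → G) (i : Fin n) :
    maskHom G S g i = if i ∈ S then g i else 1 := rfl

theorem snocOneHom_castSucc {n : ℕ} (g : Fin n → G) (i : Fin n) :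
    snocOneHom G n g i.castSucc = g i :=
  Fin.snoc_castSucc (α := fun _ => G) 1 g i

theorem snocOneHom_last {n : ℕ} (g : Fin n → G) : snocOneHom G n g (Fin.last n) = 1 :=
  Fin.snoc_last (α := fun _ => G) 1 g

theorem reindex_apply {m n : ℕ} (e : Fin m → Fin n) (g : Fin n → G) (i : Fin m) :
    reindex G e g i = g (e i) := rfl

variable (G)

/-- The `FI♯`-structure on `H^q(G^n; ℚ)`. -/
def powerFISharp (q : ℕ) : FISharp (powerRep G q) (forgetMap G q) where
  -- By functoriality each axiom reduces to an equality of homomorphisms between powers of G,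
  -- checked on coordinates.
  res n := pullback (snocOneHom G n) q
  e n S := pullback (maskHom G S) q
  consistent n σ v := by
    change pullback _ q (pullback _ q v) = pullback _ q (pullback _ q v)
    rw [pullback_pullback, pullback_pullback]
    congr 2
    ext g i
    simp [reindex_apply]
  e_univ n v := by
    have : maskHom G (Finset.univ : Finset (Fin n)) = MonoidHom.id _ := by
      ext g i
      simp [maskHom_apply]
    rw [this, pullback_id]; rfl
  e_e n S T v := by
    rw [pullback_pullback]
    congr 2
    ext g i
    simp only [MonoidHom.comp_apply, maskHom_apply, Finset.mem_inter]
    split_ifs <;> tauto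
  ρ_e n σ S v := by
    change pullback _ q (pullback _ q v) = pullback _ q (pullback _ q v)
    rw [pullback_pullback, pullback_pullback]
    congr 2
    ext g i
    simp [maskHom_apply, reindex_apply]
  ρ_e_of_fixed n σ S hσ v := by
    change pullback _ q (pullback _ q v) = _
    rw [pullback_pullback]
    congr 2
    ext g i
    simp only [MonoidHom.comp_apply, maskHom_apply, reindex_apply]
    split_ifs with hi
    · rw [hσ i hi]
    · rfl
  res_ρ n σ v := by
    change pullback _ q (pullback _ q v) = pullback _ q (pullback _ q v)
    rw [pullback_pullback, pullback_pullback]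
    congr 2
    ext g i
    induction i using Fin.lastCases <;>
      simp [reindex_apply, snocOneHom_castSucc, snocOneHom_last]
  res_φ n v := by
    change pullback _ q (pullback _ q v) = v
    rw [pullback_pullback]
    have : (reindex G Fin.castSucc).comp (snocOneHom G n) = MonoidHom.id _ := by
      ext g i
      simp [reindex_apply, snocOneHom_castSucc]
    rw [this, pullback_id]; rfl
  φ_res n v := by
    change pullback _ q (pullback _ q v) = _
    rw [pullback_pullback]
    congr 2
    ext g i
    induction i using Fin.lastCases <;>
      simp [reindex_apply, snocOneHom_castSucc, snocOneHom_last, maskHom_apply]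
  φ_e n S v := by
    change pullback _ q (pullback _ q v) = pullback _ q (pullback _ q v)
    rw [pullback_pullback, pullback_pullback]
    congr 2
    ext g i
    simp [reindex_apply, maskHom_apply]
  res_swap_φ n k v := by
    change pullback _ q (pullback _ q (pullback _ q v)) = _
    rw [pullback_pullback, pullback_pullback]
    congr 2
    ext g i
    simp only [MonoidHom.comp_apply, maskHom_apply, reindex_apply, Finset.mem_filter,
      Finset.mem_univ, true_and]
    split_ifs with hi
    · rw [swap_apply_of_ne_of_ne hi (Fin.castSucc_lt_last i).ne, snocOneHom_castSucc]
    · rw [not_not] at hi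
      rw [hi, swap_apply_left, snocOneHom_last]

end Power

end

/-! ### Dimension bounds from exact sequences -/

theorem finrank_le_of_exact {A B C : Type*} [AddCommGroup A] [Module ℚ A] [AddCommGroup B]
    [Module ℚ B] [AddCommGroup C] [Module ℚ C] (f : A →ₗ[ℚ] B) (g : B →ₗ[ℚ] C)
    (h : LinearMap.ker g ≤ LinearMap.range f) [FiniteDimensional ℚ A] [FiniteDimensional ℚ C] :
    FiniteDimensional ℚ B ∧
      Module.finrank ℚ B ≤ Module.finrank ℚ A + Module.finrank ℚ (LinearMap.range g) := by
  have hk : FiniteDimensional ℚ (LinearMap.ker g) := Submodule.finiteDimensional_of_le h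
  have hB : FiniteDimensional ℚ B := by
    have hq : FiniteDimensional ℚ (B ⧸ LinearMap.ker g) :=
      Module.Finite.equiv g.quotKerEquivRange.symm
    exact Module.Finite.of_submodule_quotient (LinearMap.ker g)
  refine ⟨hB, ?_⟩
  rw [← LinearMap.finrank_range_add_finrank_ker g, add_comm]
  gcongr
  exact (Submodule.finrank_mono h).trans (LinearMap.finrank_range_le f)

/-! ### Dimension shifting along a finite coresolution -/

section Cohomology

variable {G H : Type} [Group G] [Group H]

/-- The functor `A ↦ H^i(H; A)` on representations of `G`, for a homomorphism `p : H → G`. -/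
def resCohomology (p : H →* G) (i : ℕ) : Rep.{0} ℚ G ⥤ ModuleCat.{0} ℚ :=
  Rep.resFunctor p ⋙ groupCohomology.cochainsFunctor ℚ H ⋙
    HomologicalComplex.homologyFunctor (ModuleCat ℚ) (ComplexShape.up ℕ) i

instance (p : H →* G) (i : ℕ) : (resCohomology p i).Additive :=
  inferInstanceAs (Rep.resFunctor p ⋙ groupCohomology.cochainsFunctor ℚ H ⋙
    HomologicalComplex.homologyFunctor (ModuleCat ℚ) (ComplexShape.up ℕ) i).Additive

theorem resCohomology_exact (p : H →* G) {X : ShortComplex (Rep.{0} ℚ G)} (hX : X.ShortExact)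
    (i : ℕ) : ∃ δ : (resCohomology p i).obj X.X₃ →ₗ[ℚ] (resCohomology p (i + 1)).obj X.X₁,
      LinearMap.ker ((resCohomology p (i + 1)).map X.f).hom ≤ LinearMap.range δ := by
  have h := groupCohomology.map_cochainsFunctor_shortExact ((Rep.shortExact_res p).2 hX)
  refine ⟨(h.δ i (i + 1) rfl).hom, ?_⟩
  exact ((ShortComplex.moduleCat_exact_iff_range_eq_ker _).1 (h.homology_exact₁ i (i + 1) rfl)).ge

theorem resCohomology_zero_ker (p : H →* G) {A B : Rep.{0} ℚ G} (f : A ⟶ B)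
    (hf : Function.Injective f.hom) : LinearMap.ker ((resCohomology p 0).map f).hom = ⊥ := by
  have : Mono ((Rep.resFunctor p).map f) := (Rep.mono_iff_injective _).2 hf
  have h2 : Mono ((resCohomology p 0).map f) :=
    groupCohomology.mono_map_0_of_mono ((Rep.resFunctor p).map f)
  rw [LinearMap.ker_eq_bot]
  exact (ModuleCat.mono_iff_injective _).1 h2

/-- The representation of `G` on the functions `G → ℚ` by left translation. -/
abbrev funRep (G : Type) [Group G] : Rep.{0} ℚ G :=
  Rep.of (X := G → ℚ)
    { toFun := fun g => LinearMap.funLeft ℚ ℚ fun x => g⁻¹ * x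
      map_one' := by ext; simp [LinearMap.funLeft]
      map_mul' := fun g h => by ext; simp [LinearMap.funLeft, mul_assoc] }

theorem funRep_ρ_apply (g : G) (c : G → ℚ) (x : G) : (funRep G).ρ g c x = c (g⁻¹ * x) := rfl

/-- A resolution of the trivial representation by direct summands of finite sums of `funRep G`. -/
structure FinCoresolution (G : Type) [Group G] where
  /-- The cosyzygies. -/
  M : ℕ → Rep.{0} ℚ G
  /-- The terms of the resolution. -/
  I : ℕ → Rep.{0} ℚ G
  f : ∀ j, M j ⟶ I j
  g : ∀ j, I j ⟶ M (j + 1)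
  w : ∀ j, f j ≫ g j = 0
  shortExact : ∀ j, (ShortComplex.mk (f j) (g j) (w j)).ShortExact
  r : ℕ → ℕ
  a : ∀ j, Fin (r j) → (I j ⟶ funRep G)
  b : ∀ j, Fin (r j) → (funRep G ⟶ I j)
  sum_eq : ∀ j, ∑ k, a j k ≫ b j k = 𝟙 (I j)
  iso : Rep.trivial ℚ G ℚ ≅ M 0

namespace FinCoresolution

variable (R : FinCoresolution G) (p : H →* G)

theorem sum_map_eq (i j : ℕ) (x : (resCohomology p i).obj (R.I j)) :
    ∑ k, ((resCohomology p i).map (R.b j k)).hom (((resCohomology p i).map (R.a j k)).hom x) =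
      x := by
  have h := congrArg (fun φ => ((resCohomology p i).map φ).hom x) (R.sum_eq j)
  simp only [Functor.map_sum, Functor.map_comp] at h
  simpa [ModuleCat.hom_sum] using h

/-- The inclusion of the trivial representation as the constant functions. -/
def constHom (G : Type) [Group G] : Rep.trivial ℚ G ℚ ⟶ funRep G :=
  Rep.ofHom ⟨LinearMap.pi fun _ => LinearMap.id, fun g => by ext; rfl⟩

/-- Multiplication by a scalar. -/
def scalarHom (A : Rep.{0} ℚ G) (t : ℚ) : A ⟶ A :=
  Rep.ofHom ⟨t • LinearMap.id, fun g => by ext; simp⟩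

/-- The image of 1 is an invariant function on G, hence constant. -/
theorem exists_eq_constHom_comp (φ : Rep.trivial ℚ G ℚ ⟶ funRep G) :
    ∃ t : ℚ, φ = constHom G ≫ scalarHom (funRep G) t := by
  let c : G → ℚ := φ.hom (1 : ℚ)
  refine ⟨c 1, Rep.hom_ext ?_⟩
  have h1 : ∀ x, c x = c 1 := fun x => by
    have := congrFun (Rep.hom_comm_apply φ x (1 : ℚ)) x
    rw [funRep_ρ_apply, inv_mul_cancel] at this
    exact this
  ext x
  change c x = c 1 • (1 : ℚ)
  rw [h1 x, smul_eq_mul, mul_one]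

/-- Every component of M₀ → I₀ is a scalar multiple of the inclusion of constants. So the map on
cohomology has rank at most that of a single `funRep G`, whatever the value of `r 0`. -/
theorem ker_constHom_le (i : ℕ) :
    LinearMap.ker ((resCohomology p i).map (R.iso.inv ≫ constHom G)).hom ≤
      LinearMap.ker ((resCohomology p i).map (R.f 0)).hom := by
  intro x hx
  rw [LinearMap.mem_ker] at hx ⊢
  rw [← R.sum_map_eq p i 0 (((resCohomology p i).map (R.f 0)).hom x)]
  refine Finset.sum_eq_zero fun k _ => ?_
  obtain ⟨t, ht⟩ := exists_eq_constHom_comp (R.iso.hom ≫ R.f 0 ≫ R.a 0 k)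
  have h1 : R.f 0 ≫ R.a 0 k = (R.iso.inv ≫ constHom G) ≫ scalarHom _ t := by
    rw [Category.assoc, ← ht, Iso.inv_hom_id_assoc]
  have h2 : ((resCohomology p i).map (R.a 0 k)).hom (((resCohomology p i).map (R.f 0)).hom x) =
      0 := by
    rw [← ModuleCat.comp_apply, ← Functor.map_comp, h1, Functor.map_comp, ModuleCat.comp_apply]
    exact (congrArg _ hx).trans (map_zero _)
  rw [h2, map_zero]

variable [hfin : ∀ i, FiniteDimensional ℚ ((resCohomology p i).obj (funRep G))]

theorem finrank_I (i j : ℕ) : FiniteDimensional ℚ ((resCohomology p i).obj (R.I j)) ∧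
    Module.finrank ℚ ((resCohomology p i).obj (R.I j)) ≤
      R.r j * Module.finrank ℚ ((resCohomology p i).obj (funRep G)) := by
  let L : (resCohomology p i).obj (R.I j) →ₗ[ℚ]
      (Fin (R.r j) → (resCohomology p i).obj (funRep G)) :=
    LinearMap.pi fun k => ((resCohomology p i).map (R.a j k)).hom
  have hL : Function.Injective L := by
    intro x y hxy
    rw [← R.sum_map_eq p i j x, ← R.sum_map_eq p i j y]
    exact Finset.sum_congr rfl fun k _ => congrArg _ (congrFun hxy k)
  refine ⟨FiniteDimensional.of_injective L hL,
    (LinearMap.finrank_le_finrank_of_injective hL).trans ?_⟩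
  rw [Module.finrank_pi_fintype]
  simp

/-- Dimension shifting: H^{i+1}(M_j) is squeezed between H^i(M_{j+1}) and H^{i+1}(I_j), down to
degree 0, where M_j → I_j is injective on cohomology. -/
theorem finrank_M (i j : ℕ) : FiniteDimensional ℚ ((resCohomology p i).obj (R.M j)) ∧
    Module.finrank ℚ ((resCohomology p i).obj (R.M j)) ≤
      ∑ l ∈ Finset.range (i + 1),
        R.r (j + l) * Module.finrank ℚ ((resCohomology p (i - l)).obj (funRep G)) := by
  induction i generalizing j with
  | zero =>
    obtain ⟨h1, h2⟩ := R.finrank_I p 0 j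
    have hinj : Function.Injective ((resCohomology p 0).map (R.f j)).hom :=
      LinearMap.ker_eq_bot.1 (resCohomology_zero_ker p (R.f j)
        ((Rep.mono_iff_injective _).1 (R.shortExact j).mono_f))
    refine ⟨FiniteDimensional.of_injective _ hinj,
      (LinearMap.finrank_le_finrank_of_injective hinj).trans ?_⟩
    simpa using h2
  | succ i ih =>
    obtain ⟨h1, h2⟩ := R.finrank_I p (i + 1) j
    obtain ⟨h3, h4⟩ := ih (j + 1)
    obtain ⟨δ, hδ⟩ := resCohomology_exact p (R.shortExact j) i
    obtain ⟨h5, h6⟩ := finrank_le_of_exact δ _ hδ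
    refine ⟨h5, h6.trans ?_⟩
    rw [Finset.sum_range_succ']
    refine add_le_add (h4.trans (le_of_eq (Finset.sum_congr rfl fun l _ => ?_)))
      ((Submodule.finrank_le _).trans ?_)
    · rw [Nat.add_sub_add_right, add_assoc, add_comm 1 l]
    · simpa using h2

theorem finrank_trivial (R : FinCoresolution G) (i : ℕ) :
    FiniteDimensional ℚ ((resCohomology p i).obj (Rep.trivial ℚ G ℚ)) := by
  have := (R.finrank_M p i 0).1
  exact Module.Finite.equiv ((resCohomology p i).mapIso R.iso).symm.toLinearEquiv

theorem finrank_range_le_of_ker_le {A B C : Type*} [AddCommGroup A] [Module ℚ A] [AddCommGroup B]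
    [Module ℚ B] [AddCommGroup C] [Module ℚ C] [FiniteDimensional ℚ A] (u : A →ₗ[ℚ] B)
    (v : A →ₗ[ℚ] C) (h : LinearMap.ker u ≤ LinearMap.ker v) :
    Module.finrank ℚ (LinearMap.range v) ≤ Module.finrank ℚ (LinearMap.range u) := by
  have h1 := LinearMap.finrank_range_add_finrank_ker u
  have h2 := LinearMap.finrank_range_add_finrank_ker v
  have h3 := Submodule.finrank_mono h
  omega

/-- The coefficient 1 of the top term, instead of `r 0`, is essential: iterating a factor `r 0`
would only give an exponential bound in the number of factors of G^n. -/
theorem finrank_trivial_succ (i : ℕ) :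
    Module.finrank ℚ ((resCohomology p (i + 1)).obj (Rep.trivial ℚ G ℚ)) ≤
      Module.finrank ℚ ((resCohomology p (i + 1)).obj (funRep G)) +
        ∑ l ∈ Finset.range (i + 1),
          R.r (1 + l) * Module.finrank ℚ ((resCohomology p (i - l)).obj (funRep G)) := by
  obtain ⟨h3, h4⟩ := R.finrank_M p i 1
  have h0 := (R.finrank_M p (i + 1) 0).1
  have h1 := (R.finrank_I p (i + 1) 0).1
  obtain ⟨δ, hδ⟩ := resCohomology_exact p (R.shortExact 0) i
  have h6 := (finrank_le_of_exact δ _ hδ).2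
  rw [((resCohomology p (i + 1)).mapIso R.iso).toLinearEquiv.finrank_eq]
  refine h6.trans ((add_le_add h4 ?_).trans (add_comm _ _).le)
  exact (finrank_range_le_of_ker_le _ _ (R.ker_constHom_le p (i + 1))).trans
    (Submodule.finrank_le _)

theorem finrank_trivial_zero :
    Module.finrank ℚ ((resCohomology p 0).obj (Rep.trivial ℚ G ℚ)) ≤
      Module.finrank ℚ ((resCohomology p 0).obj (funRep G)) := by
  refine LinearMap.finrank_le_finrank_of_injective
    (f := ((resCohomology p 0).map (constHom G)).hom) ?_
  rw [← LinearMap.ker_eq_bot]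
  exact resCohomology_zero_ker p _ fun x y hxy => congrFun hxy 1

end FinCoresolution

/-! ### Shapiro's lemma -/

theorem mem_coindV_comp (p : H →* G) (c : G → ℚ) :
    (fun h => c (p h)⁻¹) ∈ Representation.coindV p.ker.subtype
      (Representation.trivial ℚ p.ker ℚ) := by
  intro k h
  have : p k = 1 := k.2
  simp [this]

/-- Functions on the quotient `G` of `H` are coinduced from the kernel. -/
def funRepEquivCoind (p : H →* G) (hp : Function.Surjective p) :
    (G → ℚ) ≃ₗ[ℚ] Representation.coindV p.ker.subtype (Representation.trivial ℚ p.ker ℚ) :=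
  LinearEquiv.ofBijective
    { toFun := fun c => ⟨fun h => c (p h)⁻¹, mem_coindV_comp p c⟩
      map_add' := fun _ _ => rfl
      map_smul' := fun _ _ => rfl } <| by
    constructor
    · intro c c' e
      funext x
      obtain ⟨h, hh⟩ := hp x⁻¹
      have := congrFun (congrArg Subtype.val e) h
      simpa [hh] using this
    · rintro ⟨F, hF⟩
      choose s hs using hp
      -- An element of the coinduced module is constant on the fibres of p, so any section s
      -- recovers it. The inverse turns left translation on G into right translation on H.
      refine ⟨fun x => F (s x⁻¹), Subtype.ext (funext fun h => ?_)⟩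
      have h1 : s (p h) * h⁻¹ ∈ p.ker := by
        rw [MonoidHom.mem_ker, map_mul, hs, map_inv, mul_inv_cancel]
      have h2 := hF ⟨_, h1⟩ h
      simpa using h2

/-- The restriction of `funRep G` to `H` is coinduced from the kernel. -/
def resFunRepIso (p : H →* G) (hp : Function.Surjective p) :
    Rep.res p (funRep G) ≅ Rep.coind p.ker.subtype (Rep.trivial ℚ p.ker ℚ) :=
  Rep.mkIso <| .mk (funRepEquivCoind p hp) fun h => by
    ext c : 1
    apply Subtype.ext
    funext x
    change c ((p h)⁻¹ * (p x)⁻¹) = c (p (x * h))⁻¹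
    rw [map_mul, mul_inv_rev]

/-- Shapiro's lemma for the functions on a quotient group. -/
def resCohomologyFunRepIso (p : H →* G) (hp : Function.Surjective p) (i : ℕ) :
    (resCohomology p i).obj (funRep G) ≅ rationalCohomology p.ker i :=
  (groupCohomology.functor ℚ H i).mapIso (resFunRepIso p hp) ≪≫
    groupCohomology.coindIso (Rep.trivial ℚ p.ker ℚ) i

/-- Isomorphic groups have isomorphic cohomology. -/
def rationalCohomologyEquiv (e : G ≃* H) (i : ℕ) :
    rationalCohomology H i ≃ₗ[ℚ] rationalCohomology G i :=
  LinearEquiv.ofLinearMap (pullback e.toMonoidHom i) (pullback e.symm.toMonoidHom i)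
    (by rw [← pullback_comp]; convert pullback_id G i; ext; simp)
    (by rw [← pullback_comp]; convert pullback_id H i; ext; simp)

end Cohomology

/-! ### Growth of the cohomology of the powers of a group -/

section Growth

variable {G : Type} [Group G]

/-- The kernel of the last coordinate of `G^{n+1}` is `G^n`. -/
def kerLastEquiv (G : Type) [Group G] (n : ℕ) :
    (Fin n → G) ≃* (Pi.evalMonoidHom (fun _ : Fin (n + 1) => G) (Fin.last n)).ker where
  toFun g := ⟨snocOneHom G n g, snocOneHom_last g⟩
  invFun k := reindex G Fin.castSucc k.1
  left_inv g := by
    ext i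
    exact snocOneHom_castSucc g i
  right_inv k := by
    ext i
    induction i using Fin.lastCases with
    | last => exact (snocOneHom_last _).trans k.2.symm
    | cast i => exact snocOneHom_castSucc _ i
  map_mul' g h := Subtype.ext (map_mul (snocOneHom G n) g h)

/-- Shapiro's lemma for the last coordinate of `G^{n+1}`. -/
def resCohomologyLastEquiv (G : Type) [Group G] (n i : ℕ) :
    (resCohomology (Pi.evalMonoidHom (fun _ : Fin (n + 1) => G) (Fin.last n)) i).obj (funRep G)
      ≃ₗ[ℚ] rationalCohomology (Fin n → G) i :=
  (resCohomologyFunRepIso _ (Function.surjective_eval _) i).toLinearEquiv ≪≫ₗ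
    rationalCohomologyEquiv (kerLastEquiv G n) i

theorem finiteDimensional_rationalCohomology_of_finite (H : Type) [Group H] [Finite H] (i : ℕ) :
    FiniteDimensional ℚ (rationalCohomology H i) := by
  have h1 : FiniteDimensional ℚ ((groupCohomology.inhomogeneousCochains
      (Rep.trivial ℚ H ℚ)).X i) :=
    inferInstanceAs (FiniteDimensional ℚ ((Fin i → H) → ℚ))
  have h2 : FiniteDimensional ℚ (groupCohomology.cocycles (Rep.trivial ℚ H ℚ) i) :=
    FiniteDimensional.of_injective (groupCohomology.iCocycles (Rep.trivial ℚ H ℚ) i).hom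
      ((ModuleCat.mono_iff_injective _).1 inferInstance)
  refine Module.Finite.of_surjective (groupCohomology.π (Rep.trivial ℚ H ℚ) i).hom fun x => ?_
  induction x using groupCohomology_induction_on with
  | h x => exact ⟨x, rfl⟩

namespace FinCoresolution

variable (R : FinCoresolution G)
include R

theorem finiteDimensional_rationalCohomology (n i : ℕ) :
    FiniteDimensional ℚ (rationalCohomology (Fin n → G) i) := by
  induction n generalizing i with
  | zero => exact finiteDimensional_rationalCohomology_of_finite _ i
  | succ n ih =>
    have hfin := fun i => Module.Finite.equiv (resCohomologyLastEquiv G n i).symm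
    exact R.finrank_trivial (Pi.evalMonoidHom (fun _ : Fin (n + 1) => G) (Fin.last n)) i

theorem finrank_rationalCohomology_succ (n i : ℕ) :
    Module.finrank ℚ (rationalCohomology (Fin (n + 1) → G) (i + 1)) ≤
      Module.finrank ℚ (rationalCohomology (Fin n → G) (i + 1)) +
        ∑ l ∈ Finset.range (i + 1),
          R.r (1 + l) * Module.finrank ℚ (rationalCohomology (Fin n → G) (i - l)) := by
  have hfd := R.finiteDimensional_rationalCohomology n
  have hfin := fun i => Module.Finite.equiv (resCohomologyLastEquiv G n i).symm
  have h := R.finrank_trivial_succ (Pi.evalMonoidHom (fun _ : Fin (n + 1) => G) (Fin.last n)) i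
  simp only [fun i => (resCohomologyLastEquiv G n i).finrank_eq] at h
  exact h

theorem finrank_rationalCohomology_zero_succ (n : ℕ) :
    Module.finrank ℚ (rationalCohomology (Fin (n + 1) → G) 0) ≤
      Module.finrank ℚ (rationalCohomology (Fin n → G) 0) := by
  have hfd := R.finiteDimensional_rationalCohomology n
  have hfin := fun i => Module.Finite.equiv (resCohomologyLastEquiv G n i).symm
  have h := finrank_trivial_zero (Pi.evalMonoidHom (fun _ : Fin (n + 1) => G) (Fin.last n))
  simp only [fun i => (resCohomologyLastEquiv G n i).finrank_eq] at h
  exact h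

/-- The dimension of `H^q(G^n; ℚ)` is bounded by a polynomial in `n` of degree `q`. -/
theorem exists_finrank_le (q : ℕ) :
    ∃ C : ℕ, ∀ n, Module.finrank ℚ (rationalCohomology (Fin n → G) q) ≤ C * (n + 1) ^ q := by
  induction q using Nat.strong_induction_on with
  | _ q ih =>
    match q with
    | 0 =>
      refine ⟨Module.finrank ℚ (rationalCohomology (Fin 0 → G) 0), fun n => ?_⟩
      rw [pow_zero, mul_one]
      exact antitone_nat_of_succ_le
        (f := fun n => Module.finrank ℚ (rationalCohomology (Fin n → G) 0))
        R.finrank_rationalCohomology_zero_succ (Nat.zero_le n)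
    | q + 1 =>
      choose! C hC using ih
      let d := Module.finrank ℚ (rationalCohomology (Fin 0 → G) (q + 1))
      let K := ∑ l ∈ Finset.range (q + 1), R.r (1 + l) * C (q - l)
      -- `d` is the value at n = 0 and `K (n + 1)^q` bounds each increment. The induction closes
      -- because (n + 1)^{q+1} + (n + 1)^q = (n + 1)^q (n + 2) ≤ (n + 2)^{q+1}.
      refine ⟨d + K, fun n => ?_⟩
      induction n with
      | zero => simp [d]
      | succ n hn =>
        have h1 : ∑ l ∈ Finset.range (q + 1),
            R.r (1 + l) * Module.finrank ℚ (rationalCohomology (Fin n → G) (q - l)) ≤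
              K * (n + 1) ^ q := by
          rw [Finset.sum_mul]
          refine Finset.sum_le_sum fun l _ => ?_
          rw [mul_assoc]
          gcongr
          refine (hC (q - l) (by omega) n).trans ?_
          gcongr <;> omega
        calc _ ≤ (d + K) * (n + 1) ^ (q + 1) + K * (n + 1) ^ q :=
              (R.finrank_rationalCohomology_succ n q).trans (add_le_add hn h1)
          _ ≤ (d + K) * (n + 1) ^ (q + 1) + (d + K) * (n + 1) ^ q := by gcongr; omega
          _ = (d + K) * ((n + 1) ^ q * (n + 1 + 1)) := by ring
          _ ≤ (d + K) * ((n + 1 + 1) ^ q * (n + 1 + 1)) := by gcongr; omega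
          _ = _ := by rw [pow_succ]

end FinCoresolution

end Growth

/-! ### The dual of a projective resolution -/

section Ring

variable {k G : Type} [CommRing k] [Group G]

/-- The additive homomorphism underlying a homomorphism of representations. -/
def addHom {A B : Rep.{0} k G} (u : A ⟶ B) : A →+ B := u.hom.toLinearMap.toAddMonoidHom

theorem addHom_rho {A B : Rep.{0} k G} (u : A ⟶ B) (g : G) (x : A) :
    addHom u (A.ρ g x) = B.ρ g (addHom u x) := Rep.hom_comm_apply u g x

theorem addHom_addHom {A B C : Rep.{0} k G} {v : C ⟶ B} {u : B ⟶ A} (h : v ≫ u = 0) (x : C) :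
    addHom u (addHom v x) = 0 := congrArg (fun w : C ⟶ A => w.hom x) h

theorem exists_of_exact {A B C : Rep.{0} k G} {v : C ⟶ B} {u : B ⟶ A} {h : v ≫ u = 0}
    (hS : (ShortComplex.mk v u h).Exact) (x : B) (hx : addHom u x = 0) : ∃ y, addHom v y = x :=
  (ShortComplex.moduleCat_exact_iff _).1
    (hS.map (forget₂ (Rep.{0} k G) (ModuleCat.{0} k))) x hx

theorem shortExact_of_elementwise {X Y Z : Rep.{0} k G} (f : X ⟶ Y) (g : Y ⟶ Z) (w : f ≫ g = 0)
    (hf : Function.Injective f.hom) (hg : Function.Surjective g.hom)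
    (h : ∀ y, g.hom y = 0 → ∃ x, f.hom x = y) : (ShortComplex.mk f g w).ShortExact where
  exact := by
    rw [← ShortComplex.exact_map_iff_of_faithful _ (forget₂ (Rep.{0} k G) (ModuleCat.{0} k)),
      ShortComplex.moduleCat_exact_iff]
    exact h
  mono_f := (Rep.mono_iff_injective _).2 hf
  epi_g := (Rep.epi_iff_surjective _).2 hg

theorem surjective_π (P : ProjectiveResolution (Rep.trivial k G k)) :
    Function.Surjective (addHom (P.π.f 0)) := by
  have : Epi (P.π.f 0) := inferInstance
  exact (Rep.epi_iff_surjective (P.π.f 0)).1 this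

/-- The action of a group element as an additive automorphism. -/
def actHom (A : Rep.{0} k G) (g : G) : A →+ A := (A.ρ g).toAddMonoidHom

/-- A finitely generated projective representation is a direct summand of a free one. -/
theorem exists_dual_basis (A : Rep.{0} k G) [Projective A] (hA : IsFinitelyGenerated A) :
    ∃ (n : ℕ) (e : Fin n → A) (φ : Fin n → A →+ MonoidAlgebra k G),
      (∀ i g x, φ i (A.ρ g x) = MonoidAlgebra.single g 1 * φ i x) ∧
      ∀ x, ∑ i, (φ i x).coeff.sum (fun g m => m • A.ρ g (e i)) = x := by
  have hfin : Module.Finite (MonoidAlgebra k G) A.ρ.asModule := hA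
  have h1 : Projective (ModuleCat.of (MonoidAlgebra k G) A.ρ.asModule) :=
    (Rep.equivalenceModuleMonoidAlgebra.map_projective_iff A).2 inferInstance
  have hproj : Module.Projective (MonoidAlgebra k G) A.ρ.asModule :=
    (IsProjective.iff_projective _).2 h1
  obtain ⟨n, f, g, -, -, hfg⟩ :=
    Module.Finite.exists_comp_eq_id_of_projective (MonoidAlgebra k G) A.ρ.asModule
  refine ⟨n, fun i => A.ρ.asModuleEquiv (f fun j => if i = j then 1 else 0), fun i =>
    (LinearMap.proj i ∘ₗ g).toAddMonoidHom.comp A.ρ.asModuleEquiv.symm.toAddMonoidHom,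
    fun i s x => ?_, fun x => ?_⟩
  · change g (A.ρ.asModuleEquiv.symm (A.ρ s x)) i = _ * g (A.ρ.asModuleEquiv.symm x) i
    rw [Representation.asModuleEquiv_symm_map_rho, map_smul]
    rfl
  · have h2 : f (g (A.ρ.asModuleEquiv.symm x)) = _ :=
      LinearMap.congr_fun hfg (A.ρ.asModuleEquiv.symm x)
    rw [f.pi_apply_eq_sum_univ] at h2
    have h3 := congrArg A.ρ.asModuleEquiv h2
    rw [map_sum] at h3
    refine Eq.trans (Finset.sum_congr rfl fun i _ => ?_) h3
    rw [Representation.asModuleEquiv_map_smul, Representation.asAlgebraHom_def,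
      MonoidAlgebra.lift_apply]
    symm
    exact LinearMap.sum_apply (M := A) (M₂ := A) _ _ _


end Ring

/-! ### Dualizing into ℚ -/

section Dual

variable {G : Type} [Group G] {A B C : Rep.{0} ℤ G}

/-- The representation of `G` on the homomorphisms `A → ℚ`. -/
abbrev dualRep (A : Rep.{0} ℤ G) : Rep.{0} ℚ G :=
  Rep.of (X := A →+ ℚ)
    { toFun := fun g =>
        { toFun := fun F => F.comp (actHom A g⁻¹)
          map_add' := fun _ _ => rfl
          map_smul' := fun _ _ => rfl }
      map_one' := by ext; simp [actHom]
      map_mul' := fun g h => by ext; simp [actHom] }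

/-- Precomposition with a homomorphism. -/
def dualMap (u : B ⟶ A) : dualRep A ⟶ dualRep B :=
  Rep.ofHom (ρ := (dualRep A).ρ) (σ := (dualRep B).ρ)
    ⟨{ toFun := fun F => F.comp (addHom u)
       map_add' := fun _ _ => rfl
       map_smul' := fun _ _ => rfl }, fun g => by
      ext F x
      exact congrArg F (addHom_rho u g⁻¹ x).symm⟩

theorem dualMap_apply (u : B ⟶ A) (F : A →+ ℚ) (x : B) :
    ((dualMap u).hom F : B →+ ℚ) x = F (addHom u x) := rfl

/-- The homomorphisms `A → ℚ` that vanish on the image of `u`. -/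
abbrev dualKer (u : B ⟶ A) : Rep.{0} ℚ G :=
  Rep.subrepresentation (dualRep A) (LinearMap.ker (dualMap u).hom.toLinearMap) fun g F hF => by
    have h1 : (dualMap u).hom F = 0 := hF
    change (dualMap u).hom ((dualRep A).ρ g F) = 0
    rw [Rep.hom_comm_apply, h1, map_zero]

/-- The inclusion of `dualKer u`. -/
def dualKerι (u : B ⟶ A) : dualKer u ⟶ dualRep A := Rep.subtype _ _ _

/-- The corestriction of `dualMap u` to `dualKer v`. -/
def dualKerLift (v : C ⟶ B) (u : B ⟶ A) (h : v ≫ u = 0) : dualRep A ⟶ dualKer v :=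
  Rep.ofHom ⟨(dualMap u).hom.toLinearMap.codRestrict _ fun F => by
    change (dualMap v).hom ((dualMap u).hom F) = 0
    refine AddMonoidHom.ext fun x => ?_
    rw [dualMap_apply, dualMap_apply]
    rw [addHom_addHom h, map_zero]
    rfl, fun g => by
      ext F
      exact DFunLike.congr_fun (Rep.hom_comm_apply (dualMap u) g F) _⟩

/-- F descends to X / ker u, a subgroup of Y, and extends to Y because ℚ is divisible, hence
injective. -/
theorem exists_eq_comp_of_ker_le {X Y : Type} [AddCommGroup X] [AddCommGroup Y] (u : X →+ Y)
    (F : X →+ ℚ) (h : ∀ x, u x = 0 → F x = 0) :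
    ∃ F' : Y →+ ℚ, ∀ x, F' (u x) = F x := by
  have hinj : Module.Injective ℤ ℚ := (Module.Baer.of_divisible ℚ).injective
  let u' := u.toIntLinearMap
  have h' : LinearMap.ker u' ≤ LinearMap.ker F.toIntLinearMap := h
  obtain ⟨F', hF'⟩ := hinj.out ((LinearMap.ker u').liftQ u' le_rfl)
    (LinearMap.ker_eq_bot.1 (Submodule.ker_liftQ_eq_bot _ _ _ le_rfl))
    ((LinearMap.ker u').liftQ F.toIntLinearMap h')
  exact ⟨F'.toAddMonoidHom, fun x => hF' (Submodule.Quotient.mk x)⟩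

theorem dualKerι_comp_lift (v : C ⟶ B) (u : B ⟶ A) (h : v ≫ u = 0) :
    dualKerι u ≫ dualKerLift v u h = 0 := by
  refine Rep.hom_ext ?_
  ext F
  exact DFunLike.congr_fun F.2 _

/-- Exactness of Hom(-, ℚ): a functional on B killed by v factors through the image of u and extends
to A. This cuts the dual complex into short exact sequences. -/
theorem shortExact_dualKer (v : C ⟶ B) (u : B ⟶ A) (h : v ≫ u = 0)
    (hex : (ShortComplex.mk v u h).Exact) :
    (ShortComplex.mk (dualKerι u) (dualKerLift v u h) (dualKerι_comp_lift v u h)).ShortExact := by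
  refine shortExact_of_elementwise _ _ _ Subtype.val_injective ?_ ?_
  · rintro ⟨F, hF⟩
    obtain ⟨F', hF'⟩ := exists_eq_comp_of_ker_le (addHom u) F fun x hx => by
      obtain ⟨y, rfl⟩ := exists_of_exact hex x hx
      exact DFunLike.congr_fun hF y
    exact ⟨F', Subtype.ext (AddMonoidHom.ext hF')⟩
  · intro F hF
    exact ⟨⟨F, congrArg Subtype.val hF⟩, rfl⟩

/-- The homomorphisms `ℤ → ℚ` are the kernel of the dual of a presentation of `ℤ`. -/
def trivialIsoDualKer (v : B ⟶ A) (u : A ⟶ Rep.trivial ℤ G ℤ) (h : v ≫ u = 0)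
    (hex : (ShortComplex.mk v u h).Exact) (hu : Function.Surjective (addHom u)) :
    Rep.trivial ℚ G ℚ ≅ dualKer v :=
  Rep.mkIso <| .mk (LinearEquiv.ofBijective
    (LinearMap.codRestrict (LinearMap.ker (dualMap v).hom.toLinearMap)
      { toFun := fun t => ((AddMonoidHom.mulRight t).comp (Int.castAddHom ℚ)).comp (addHom u)
        map_add' := fun s t => by ext; simp [mul_add]
        map_smul' := fun s t => by ext; simp [mul_left_comm] } fun t => by
          refine AddMonoidHom.ext fun x => ?_
          change ((addHom u (addHom v x) : ℤ) : ℚ) * t = 0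
          rw [addHom_addHom h]
          exact (congrArg (· * t) Int.cast_zero).trans (zero_mul t)) (by
    constructor
    · intro s t hst
      obtain ⟨x, hx⟩ := hu (1 : ℤ)
      have h1 : ((addHom u x : ℤ) : ℚ) * s = ((addHom u x : ℤ) : ℚ) * t := DFunLike.congr_fun (congrArg Subtype.val hst) x
      rwa [hx, Int.cast_one, one_mul, one_mul] at h1
    · rintro ⟨F, hF⟩
      obtain ⟨F', hF'⟩ := exists_eq_comp_of_ker_le (addHom u) F fun x hx => by
        obtain ⟨y, rfl⟩ := exists_of_exact hex x hx
        exact DFunLike.congr_fun hF y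
      refine ⟨F' (1 : ℤ), Subtype.ext (AddMonoidHom.ext fun x => ?_)⟩
      rw [← hF']
      change ((addHom u x : ℤ) : ℚ) * F' (1 : ℤ) = F' (addHom u x)
      rw [← zsmul_eq_mul, ← map_zsmul]
      exact congrArg F' (mul_one (addHom u x : ℤ)))) fun g => by
    ext x
    exact congrArg (fun m : ℤ => (m : ℚ) * 1) (addHom_rho u g⁻¹ x).symm

/-- The additive map on the group ring given by a function on the group. -/
def integrate (c : G → ℚ) : MonoidAlgebra ℤ G →+ ℚ :=
  (Finsupp.liftAddHom fun g => (AddMonoidHom.mulRight (c g)).comp (Int.castAddHom ℚ)).comp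
    MonoidAlgebra.coeffAddEquiv.toAddMonoidHom

omit [Group G] in
theorem integrate_apply (c : G → ℚ) (y : MonoidAlgebra ℤ G) :
    integrate c y = y.coeff.sum fun g m => (m : ℚ) * c g := rfl

theorem integrate_single_mul (c : G → ℚ) (g : G) (y : MonoidAlgebra ℤ G) :
    integrate c (MonoidAlgebra.single g 1 * y) = integrate (fun h => c (g * h)) y := by
  induction y using MonoidAlgebra.induction_linear with
  | zero => simp
  | add x y hx hy => rw [mul_add, map_add, map_add, hx, hy]
  | single h m => simp [MonoidAlgebra.single_mul_single, integrate_apply]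

/-- The homomorphism to `funRep G` given by the values on the orbit of `e`. -/
def orbitHom (e : A) : dualRep A ⟶ funRep G :=
  Rep.ofHom (ρ := (dualRep A).ρ) (σ := (funRep G).ρ)
    ⟨{ toFun := fun F h => F (A.ρ h e)
       map_add' := fun _ _ => rfl
       map_smul' := fun _ _ => rfl }, fun g => by
      ext F h
      change F (A.ρ g⁻¹ (A.ρ h e)) = F (A.ρ (g⁻¹ * h) e)
      rw [map_mul]
      rfl⟩

/-- The homomorphism from `funRep G` given by a functional with values in the group ring. -/
def integrateHom (φ : A →+ MonoidAlgebra ℤ G)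
    (hφ : ∀ g x, φ (A.ρ g x) = MonoidAlgebra.single g 1 * φ x) : funRep G ⟶ dualRep A :=
  Rep.ofHom (ρ := (funRep G).ρ) (σ := (dualRep A).ρ)
    ⟨{ toFun := fun c => (integrate c).comp φ
       map_add' := fun c c' => by
        ext x
        simp [integrate_apply, mul_add]
       map_smul' := fun t c => by
        ext x
        simp [integrate_apply, Finsupp.mul_sum, mul_left_comm] }, fun g => by
      ext c x
      change integrate (fun h => c (g⁻¹ * h)) (φ x) = integrate c (φ (A.ρ g⁻¹ x))
      rw [hφ, integrate_single_mul]⟩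

/-- The dual of a finitely generated projective representation is a direct summand of a finite sum
of copies of `funRep G`. -/
theorem exists_sum_eq_id_dualRep (A : Rep.{0} ℤ G) [Projective A] (hA : IsFinitelyGenerated A) :
    ∃ (r : ℕ) (a : Fin r → (dualRep A ⟶ funRep G)) (b : Fin r → (funRep G ⟶ dualRep A)),
      ∑ k, a k ≫ b k = 𝟙 (dualRep A) := by
  obtain ⟨n, e, φ, hφ, hsum⟩ := exists_dual_basis A hA
  refine ⟨n, fun i => orbitHom (e i), fun i => integrateHom (φ i) (hφ i), ?_⟩
  -- F applied to the dual basis expansion x = ∑ᵢ φᵢ(x) eᵢ, expanded over the group elements.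
  have key (F : A →+ ℚ) (x : A) :
      ∑ i, integrate (fun h => F (A.ρ h (e i))) (φ i x) = F x := by
    conv_rhs => rw [← hsum x, map_sum]
    refine Finset.sum_congr rfl fun i _ => ?_
    rw [integrate_apply, map_finsuppSum]
    refine Finsupp.sum_congr fun g _ => ?_
    exact ((congrArg F (int_smul_eq_zsmul A.hV2 _ _)).trans
      ((map_zsmul F _ _).trans (zsmul_eq_mul _ _))).symm
  refine Rep.hom_ext ?_
  ext F x
  rw [Rep.sum_hom]
  refine Eq.trans ?_ (key F x)
  let ev : ((dualRep A).ρ.IntertwiningMap (dualRep A).ρ) →+ ℚ :=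
    { toFun := fun u => (u F : A →+ ℚ) x
      map_zero' := rfl
      map_add' := fun _ _ => rfl }
  exact map_sum ev _ _

/-- A group of type `FP_∞` has a coresolution by finite sums of copies of `funRep G`. -/
theorem IsFPInfty.nonempty_finCoresolution (hG : IsFPInfty G) : Nonempty (FinCoresolution G) := by
  obtain ⟨P, hP⟩ := hG
  choose r a b hab using fun j => exists_sum_eq_id_dualRep (P.complex.X j) (hP j)
  exact ⟨{
    -- M_j consists of the j-cocycles of Hom(P, ℚ); M₀ is Hom(ℤ, ℚ) = ℚ by exactness at P₀.
    M := fun j => dualKer (P.complex.d (j + 1) j)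
    I := fun j => dualRep (P.complex.X j)
    f := fun j => dualKerι _
    g := fun j => dualKerLift (P.complex.d (j + 2) (j + 1)) (P.complex.d (j + 1) j)
      (P.complex.d_comp_d _ _ _)
    w := fun j => dualKerι_comp_lift _ _ _
    shortExact := fun j => shortExact_dualKer _ _ _ (P.exact_succ j)
    r := r
    a := a
    b := b
    sum_eq := hab
    iso := trivialIsoDualKer (P.complex.d 1 0) (P.π.f 0) P.complex_d_comp_π_f_zero P.exact₀
      (surjective_π P) }⟩

end Dual

end RepStab

end

theorem mainTheorem10 (G : Type) [Group G] (hG : RepStab.IsFPInfty G) (q : ℕ) :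
    RepStab.MonotoneSeq (RepStab.powerRep G q) (RepStab.forgetMap G q) (2 * q) ∧
      RepStab.UniformlyRepStable (RepStab.powerRep G q) (RepStab.forgetMap G q) (2 * q) := by
  obtain ⟨R⟩ := hG.nonempty_finCoresolution
  have hfin := fun n => R.finiteDimensional_rationalCohomology n q
  obtain ⟨C, hC⟩ := R.exists_finrank_le q
  exact ⟨(RepStab.powerFISharp G q).monotoneSeq _, (RepStab.powerFISharp G q).uniformlyRepStable
    ((RepStab.powerFISharp G q).proj_eq_zero_of_growth hC)⟩
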